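/- Let $I=[a,b]\subset\mathbb R$ be a compact interval, possibly a point ($a=b$), let $x_0,\xi_0\in\mathbb R^n$, $\Gamma=\{(t,x_0,\xi_0):t\in I\}$, and let $f=f(t,x,\xi)$ be a real valued $C^\infty$ function on an open neighborhood $V$ of $\Gamma$ in $\mathbb R\times\mathbb R^n\times\mathbb R^n$. Assume that $t\mapsto f(t,x_0,\xi_0)$ changes sign from $+$ to $-$ as $t$ increases near $I$, i.e. every neighborhood of $I$ contains points $s<t$ with $f(s,x_0,\xi_0)>0>f(t,x_0,\xi_0)$. If $|I|\neq 0$, assume also that $\partial_t^k\partial_x^\alpha\partial_\xi^\beta f(t,x_0,\xi_0)=0$ for all $k,\alpha,\beta$ and all $t\in I$. Then for every neighborhood $\Omega$ of $\Gamma$ and every $M\in\mathbb N$ there exist an integer $K\ge 2$, an open interval $J$, points $t_1<t_2$ in $J$, constants $r,c>0$ and $C^\infty$ functions $x_0(t),\xi_0(t)\in\mathbb R^n$, $w_0(t),w_\alpha(t)\in\mathbb C$ ($2\le|\alpha|\le K$) of $t\in J$ such that the phase $$\omega(t,x)=w_0(t)+\langle x-x_0(t),\xi_0(t)\rangle+\sum_{2\le|\alpha|\le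 K}w_\alpha(t)\,(x-x_0(t))^\alpha/\alpha!$$ has the following properties. 1. $(t,x,\xi_0(t))\in V\cap\Omega$ when $t\in J$ and $|x-x_0(t)|<r$. In particular the curve $t\mapsto(t,x_0(t),\xi_0(t))$ lies in $\Omega$, so it can be taken arbitrarily close to $\Gamma$. 2. The eikonal equation $\partial_t\omega+if(t,x,\partial_x\omega)=0$ holds modulo $O(|x-x_0(t)|^M)$, uniformly for $t\in J$ and $|x-x_0(t)|<r$. Here $f(t,x,\partial_x\omega)$ at the complex covector $\partial_x\omega=\xi_0(t)+\sigma(t,x)$ is defined by the Taylor expansion $\sum_{|\beta|\le N}\partial_\xi^\beta f(t,x,\xi_0(t))\,\sigma(t,x)^\beta/\beta!$, for any order $N\ge M$. 3. $\operatorname{Im}w_2(t)\ge c>0$ for $t\in[t_1,t_2]$, where $w_2(t)=(w_{e_i+e_j}(t))_{i,j}$. 4. $\min_{(t_1,t_2)}\operatorname{Im}w_0=0$, and $\operatorname{Im}w_0(t_1)=\operatorname{Im}w_0(t_2)=c>0$. Moreover, if $\partial_tf\ge 0$ at all points of $V$ where $f=0$, then $J$ can be chosen so that $I\subset J$. -/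

import Mathlib

open scoped ContDiff Nat

namespace Eikonal

/-- `g` changes sign from `+` to `-` as `t` increases near the interval `[a, b]`: every
neighborhood of `[a, b]` contains points `s < t` with `g s > 0 > g t`. -/
def ChangesSignNear (g : ℝ → ℝ) (a b : ℝ) : Prop :=
  ∀ ε > 0, ∃ s t : ℝ, a - ε < s ∧ s < t ∧ t < b + ε ∧ 0 < g s ∧ g t < 0

/-- The set `Γ = {(t, x, ξ) : t ∈ [a, b]}`. The case `a = b` (a point) is allowed. -/
def gam {n : ℕ} (a b : ℝ) (x ξ : EuclideanSpace ℝ (Fin n)) :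
    Set (ℝ × EuclideanSpace ℝ (Fin n) × EuclideanSpace ℝ (Fin n)) :=
  (fun t : ℝ => (t, x, ξ)) '' Set.Icc a b

/-- The phase
`ω(t,x) = w₀(t) + ⟨x - x₀(t), ξ₀(t)⟩ + ∑_{2 ≤ |α| ≤ K} w_α(t) (x - x₀(t))^α / α!`.
`Finset.piAntidiag Finset.univ k` is the set of multi-indices of length `k`. -/
noncomputable def phase {n : ℕ} (K : ℕ) (w₀ : ℝ → ℂ) (x₀ ξ₀ : ℝ → EuclideanSpace ℝ (Fin n))
    (w : (Fin n → ℕ) → ℝ → ℂ) (t : ℝ) (x : EuclideanSpace ℝ (Fin n)) : ℂ :=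
  w₀ t + ((inner ℝ (x - x₀ t) (ξ₀ t) : ℝ) : ℂ) +
    ∑ k ∈ Finset.Icc 2 K, ∑ α ∈ Finset.piAntidiag (Finset.univ : Finset (Fin n)) k,
      w α t * (∏ j, (((x - x₀ t) j : ℝ) : ℂ) ^ α j) / ((∏ j, (α j)! : ℕ) : ℂ)

/-- The complex partial derivative `∂ω/∂x_j (t, x)`. -/
noncomputable def partialX {n : ℕ} (ph : ℝ → EuclideanSpace ℝ (Fin n) → ℂ) (t : ℝ)
    (x : EuclideanSpace ℝ (Fin n)) (j : Fin n) : ℂ :=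
  fderiv ℝ (ph t) x (EuclideanSpace.single j 1)

/-- The Taylor expansion of order `N` that gives meaning to `f(t, x, ξ + σ)` for real `ξ` and
complex `σ`:
`∑_{k ≤ N} (1/k!) ∑_{j₁,…,j_k} ∂_{ξ_{j₁}} ⋯ ∂_{ξ_{j_k}} f(t, x, ξ) σ_{j₁} ⋯ σ_{j_k}`. -/
noncomputable def symbolTaylor {n : ℕ} (N : ℕ)
    (f : ℝ × EuclideanSpace ℝ (Fin n) × EuclideanSpace ℝ (Fin n) → ℝ)
    (t : ℝ) (x ξ : EuclideanSpace ℝ (Fin n)) (σ : Fin n → ℂ) : ℂ :=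
  ∑ k ∈ Finset.range (N + 1), ((k ! : ℕ) : ℂ)⁻¹ * ∑ j : Fin k → Fin n,
    ((iteratedFDeriv ℝ k (fun η => f (t, x, η)) ξ
      (fun i => EuclideanSpace.single (j i) 1) : ℝ) : ℂ) * ∏ i, σ (j i)

/-- The left-hand side `∂_t ω + i f(t, x, ∂_x ω)` of the eikonal equation, where `f(t, x, ∂_x ω)`
is given by the Taylor expansion of order `N` at the real covector `ξ₀(t)`. -/
noncomputable def eikonalLHS {n : ℕ} (N : ℕ)
    (f : ℝ × EuclideanSpace ℝ (Fin n) × EuclideanSpace ℝ (Fin n) → ℝ)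
    (ξ₀ : ℝ → EuclideanSpace ℝ (Fin n)) (ph : ℝ → EuclideanSpace ℝ (Fin n) → ℂ)
    (t : ℝ) (x : EuclideanSpace ℝ (Fin n)) : ℂ :=
  deriv (fun s => ph s x) t +
    Complex.I * symbolTaylor N f t x (ξ₀ t) (fun j => partialX ph t x j - ((ξ₀ t j : ℝ) : ℂ))

/-- The quadratic form `Im w₂(t)(v, v) = ∑_{i,j} Im w_{e_i + e_j}(t) v_i v_j`. -/
noncomputable def imW2 {n : ℕ} (w : (Fin n → ℕ) → ℝ → ℂ) (t : ℝ)
    (v : EuclideanSpace ℝ (Fin n)) : ℝ :=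
  ∑ i, ∑ j, (w (Pi.single i 1 + Pi.single j 1) t).im * v i * v j

end Eikonal

/-! Put s = x - x₀(t) and let P(s) be the part of the phase of degree ≥ 2. Modulo a high power of s,
the eikonal equation is a system of equations for Taylor coefficients in s. Degree 0 gives w₀' =
⟨x₀', ξ₀⟩ - i f. Degree 1 has to produce a real covector ξ₀'; if Im w₂ is invertible, its imaginary
part gives (Im w₂) x₀' = ∂_x f + (Re w₂) ∂_ξ f and its real part ξ₀' = (Re w₂) x₀' + (Im w₂) ∂_ξ f.
Degrees ≥ 2 give the w_α'. Together these form an ordinary differential equation for (x₀, ξ₀, w_α),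
with vector field `field f`, whose integral curves solve the eikonal equation to the desired order
(`exists_eikonal_bound`). Since Im w₀' = -f on the curve, a sign change of f from + to - there gives
Im w₀ an interior minimum (`exists_phase_of_curve`).

It remains to find, near Γ, an integral curve of `field f` with such a sign change. There are two
cases.

If ∂_t f < 0 at some zero of f near Γ, the initial Hessian w₂ can be chosen so that the drift of
(x₀, ξ₀) contributes less than |∂_t f| to the derivative of f along the curve
(`exists_curve_of_fderiv_neg`).

Otherwise ∂_t f ≥ 0 at all nearby zeros. Let u be the field that keeps (x, ξ) fixed and moves the
w_α as `field f` does. Along u the symbol changes sign by hypothesis. Suppose it did not do so along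
any nearby curve of `field f`. The set of points from which f stays ≥ 0 along `field f` is then
closed and contains the points where f > 0. The field u is tangent to it: at a zero where the (x,
ξ)-gradient is nonzero a small push makes f positive, and where that gradient vanishes u equals
`field f`. By Nagumo's theorem curves of u cannot leave the set, a contradiction
(`exists_isTraj_sign_change`).

If I is not a point, flatness of f makes `field f` vanish over Γ, so that curves starting nearby
stay close during all of I (`exists_stay_near`); if I is a point, short times suffice. -/

namespace Eikonal

open Set Filter Topology NNReal

/-! ### Smooth cutoffs -/

/-- Used twice: to make the symbol globally smooth, and to make the transport field bounded and
globally Lipschitz, so that its curves exist on prescribed intervals. -/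
theorem exists_contDiff_hasCompactSupport_eqOn {Z F : Type*} [NormedAddCommGroup Z]
    [NormedSpace ℝ Z] [FiniteDimensional ℝ Z] [NormedAddCommGroup F] [NormedSpace ℝ F]
    {O K : Set Z} (hO : IsOpen O) (hK : IsCompact K) (hKO : K ⊆ O) {g : Z → F}
    (hg : ContDiffOn ℝ ∞ g O) :
    ∃ g' : Z → F, ContDiff ℝ ∞ g' ∧ HasCompactSupport g' ∧
      ∃ O' : Set Z, IsOpen O' ∧ K ⊆ O' ∧ O' ⊆ O ∧ EqOn g' g O' := by
  obtain ⟨L, hL, hKL, hLO⟩ := exists_compact_between hK hO hKO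
  obtain ⟨χ, h1, h0, -⟩ := exists_contMDiffMap_one_nhds_of_subset_interior
    (n := (⊤ : ℕ∞)) (modelWithCornersSelf ℝ Z) hK.isClosed hKL
  have hχ : ContDiff ℝ ∞ (χ : Z → ℝ) := χ.contMDiff.contDiff
  have hsupp : Function.support (fun z => χ z • g z) ⊆ L := by
    intro z hz
    by_contra hzL
    exact hz (by simp [h0 z hzL])
  have hts : tsupport (fun z => χ z • g z) ⊆ L := closure_minimal hsupp hL.isClosed
  refine ⟨fun z => χ z • g z, ?_, HasCompactSupport.of_support_subset_isCompact hL hsupp, ?_⟩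
  · rw [contDiff_iff_contDiffAt]
    intro z
    by_cases hz : z ∈ O
    · exact hχ.contDiffAt.smul (hg.contDiffAt (hO.mem_nhds hz))
    · have : (fun z => χ z • g z) =ᶠ[𝓝 z] fun _ => 0 := by
        have : z ∉ tsupport (fun z => χ z • g z) := fun h => hz (hLO (hts h))
        exact notMem_tsupport_iff_eventuallyEq.mp this
      exact contDiffAt_const.congr_of_eventuallyEq this
  · obtain ⟨U, hU, hKU, hU1⟩ := eventually_nhdsSet_iff_exists.mp h1
    refine ⟨U ∩ O, hU.inter hO, subset_inter hKU hKO, inter_subset_right, fun z hz => ?_⟩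
    simp [hU1 z hz.1]

/-! ### Iterated derivatives along affine subspaces and Taylor's formula -/

section
variable {Z G F : Type*} [NormedAddCommGroup Z] [NormedSpace ℝ Z] [NormedAddCommGroup G]
  [NormedSpace ℝ G] [NormedAddCommGroup F] [NormedSpace ℝ F]

theorem iteratedFDeriv_comp_affine {g : Z → F} (hg : ContDiff ℝ ∞ g) (L : G →L[ℝ] Z) (z : Z)
    (k : ℕ) (x : G) :
    iteratedFDeriv ℝ k (fun y => g (z + L y)) x =
      (iteratedFDeriv ℝ k g (z + L x)).compContinuousLinearMap fun _ => L := by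
  have h : ContDiff ℝ ∞ (fun y => g (z + y)) := hg.comp (contDiff_const.add contDiff_id)
  have := L.iteratedFDeriv_comp_right h x (i := k) (mod_cast le_top)
  rw [iteratedFDeriv_comp_add_left] at this
  exact this

theorem iteratedDeriv_comp_line {g : Z → F} (hg : ContDiff ℝ ∞ g) (z q : Z) (k : ℕ) (τ : ℝ) :
    iteratedDeriv k (fun τ : ℝ => g (z + τ • q)) τ =
      iteratedFDeriv ℝ k g (z + τ • q) fun _ => q := by
  have := iteratedFDeriv_comp_affine hg (ContinuousLinearMap.toSpanSingleton ℝ q) z k τ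
  simp only [ContinuousLinearMap.toSpanSingleton_apply] at this
  rw [iteratedDeriv, this]
  simp

theorem norm_sub_taylor_le {g : Z → F} (hg : ContDiff ℝ ∞ g) (z q : Z) (m : ℕ) {C : ℝ}
    (hC : ∀ τ ∈ Icc (0 : ℝ) 1, ‖iteratedFDeriv ℝ (m + 1) g (z + τ • q)‖ ≤ C) :
    ‖g (z + q) - ∑ k ∈ Finset.range (m + 1), (k ! : ℝ)⁻¹ • iteratedFDeriv ℝ k g z fun _ => q‖
      ≤ C * ‖q‖ ^ (m + 1) := by
  have hφ : ContDiff ℝ ∞ (fun τ : ℝ => g (z + τ • q)) :=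
    hg.comp (contDiff_const.add (contDiff_id.smul contDiff_const))
  have hwi : ∀ k, ∀ τ ∈ Icc (0 : ℝ) 1,
      iteratedDerivWithin k (fun τ : ℝ => g (z + τ • q)) (Icc 0 1) τ =
      iteratedFDeriv ℝ k g (z + τ • q) fun _ => q := by
    intro k τ hτ
    rw [iteratedDerivWithin_eq_iteratedDeriv (uniqueDiffOn_Icc one_pos)
      ((hφ.of_le (mod_cast le_top)).contDiffAt) hτ, iteratedDeriv_comp_line hg]
  have h := taylor_mean_remainder_bound (f := fun τ : ℝ => g (z + τ • q)) (a := 0) (b := 1)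
    (C := C * ‖q‖ ^ (m + 1)) (x := 1) (n := m) zero_le_one
    ((hφ.of_le (mod_cast le_top)).contDiffOn) (by simp) (by
      intro τ hτ
      rw [hwi _ _ hτ]
      refine (ContinuousMultilinearMap.le_opNorm _ _).trans ?_
      simp only [Finset.prod_const, Finset.card_univ, Fintype.card_fin]
      gcongr
      exact hC τ hτ)
  rw [taylor_within_apply] at h
  have h0 : (0 : ℝ) ∈ Icc (0 : ℝ) 1 := by simp
  simp only [hwi _ _ h0, sub_zero, one_pow, mul_one, zero_smul, add_zero, one_smul] at h
  refine h.trans (div_le_self ?_ (mod_cast Nat.one_le_iff_ne_zero.mpr (Nat.factorial_ne_zero m)))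
  have := (norm_nonneg _).trans (hC 0 h0)
  positivity

/-- The derivative of order m + 1 is bounded on the product of K with the unit ball, which contains
every segment from (p, 0) to (p, s); hence the uniformity in p. -/
theorem exists_taylor_bound {P : Type*} [NormedAddCommGroup P] [NormedSpace ℝ P]
    [FiniteDimensional ℝ G] {g : P × G → F} (hg : ContDiff ℝ ∞ g) {K : Set P} (hK : IsCompact K)
    (m : ℕ) :
    ∃ C : ℝ, ∀ p ∈ K, ∀ s : G, ‖s‖ ≤ 1 →
      ‖g (p, s) - ∑ k ∈ Finset.range (m + 1), (k ! : ℝ)⁻¹ •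
        iteratedFDeriv ℝ k g (p, 0) fun _ => (0, s)‖ ≤ C * ‖s‖ ^ (m + 1) := by
  have hc : IsCompact (K ×ˢ Metric.closedBall (0 : G) 1) := hK.prod (isCompact_closedBall 0 1)
  obtain ⟨C, hC⟩ := hc.exists_bound_of_continuousOn
    (f := iteratedFDeriv ℝ (m + 1) g) (hg.continuous_iteratedFDeriv (mod_cast le_top)).continuousOn
  refine ⟨C, fun p hp s hs => ?_⟩
  have := norm_sub_taylor_le hg (p, 0) (0, s) m (C := C) (by
    intro τ hτ
    apply hC
    refine ⟨by simpa using hp, ?_⟩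
    have : |τ| ≤ 1 := abs_le.mpr ⟨by linarith [hτ.1], hτ.2⟩
    simp only [Prod.snd_add, Prod.smul_snd, zero_add, Metric.mem_closedBall, dist_zero_right,
      norm_smul, Real.norm_eq_abs]
    nlinarith [norm_nonneg s, abs_nonneg τ])
  simpa using this

theorem contDiff_iteratedFDeriv_apply {P : Type*} [NormedAddCommGroup P] [NormedSpace ℝ P]
    {g : Z → F} (hg : ContDiff ℝ ∞ g) (k : ℕ) {a : P → Z} (ha : ContDiff ℝ ∞ a) (v : Fin k → Z) :
    ContDiff ℝ ∞ fun p => iteratedFDeriv ℝ k g (a p) v := by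
  have h1 : ContDiff ℝ ∞ (iteratedFDeriv ℝ k g) := hg.iteratedFDeriv_right (mod_cast le_top)
  exact (ContinuousMultilinearMap.apply ℝ (fun _ : Fin k => Z) F v).contDiff.comp (h1.comp ha)

/-! ### Functions vanishing to infinite order -/

/-- All derivatives of `g` vanish at `z`. -/
def Flat (g : Z → F) (z : Z) : Prop := ∀ m : ℕ, iteratedFDeriv ℝ m g z = 0

theorem Flat.apply_eq_zero {g : Z → F} {z : Z} (h : Flat g z) : g z = 0 := by
  have := congrArg (fun u => u (fun _ => 0)) (h 0)
  simpa using this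

theorem Flat.fderiv {g : Z → F} {z : Z} (h : Flat g z) : Flat (fderiv ℝ g) z := by
  intro m
  rw [← norm_eq_zero, norm_iteratedFDeriv_fderiv, h, norm_zero]

theorem Flat.clm_comp {g : Z → F} (hg : ContDiff ℝ ∞ g) {z : Z} (h : Flat g z) (L : F →L[ℝ] G) :
    Flat (fun x => L (g x)) z := by
  intro m
  rw [← norm_le_zero_iff]
  refine (L.norm_iteratedFDeriv_comp_left (n := m) hg.contDiffAt (mod_cast le_top)).trans ?_
  rw [h m, norm_zero, mul_zero]

theorem Flat.iteratedFDeriv_apply {g : Z → F} (hg : ContDiff ℝ ∞ g) {z : Z} (h : Flat g z)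
    (k : ℕ) (v : Fin k → Z) : Flat (fun x => iteratedFDeriv ℝ k g x v) z := by
  induction k with
  | zero => simpa using h
  | succ k ih =>
    have hk := contDiff_iteratedFDeriv_apply hg k contDiff_id (Fin.tail v)
    have h1 := (ih (Fin.tail v)).fderiv.clm_comp (hk.fderiv_right (m := ∞) (mod_cast le_top))
      (ContinuousLinearMap.apply ℝ F (v 0))
    convert h1 using 2 with x
    have hd : DifferentiableAt ℝ (iteratedFDeriv ℝ k g) x :=
      (hg.differentiable_iteratedFDeriv (mod_cast WithTop.coe_lt_top k)) x
    have := ((ContinuousMultilinearMap.apply ℝ (fun _ : Fin k => Z) F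
      (Fin.tail v)).hasFDerivAt.comp x hd.hasFDerivAt).fderiv
    rw [iteratedFDeriv_succ_apply_left, ContinuousLinearMap.apply_apply]
    exact (congrArg (fun u => u (v 0)) this).symm

theorem Flat.comp_affine {g : Z → F} (hg : ContDiff ℝ ∞ g) {z : Z} (h : Flat g z)
    (L : G →L[ℝ] Z) : Flat (fun x => g (z + L x)) 0 := by
  intro m
  rw [iteratedFDeriv_comp_affine hg, map_zero, add_zero, h m]
  ext; simp

theorem Flat.mul {A : Type*} [NormedRing A] [NormedAlgebra ℝ A] {g k : Z → A}
    (hg : ContDiff ℝ ∞ g) (hk : ContDiff ℝ ∞ k) {z : Z} (h : Flat g z) :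
    Flat (fun x => g x * k x) z := by
  intro m
  rw [← norm_le_zero_iff]
  refine (norm_iteratedFDeriv_mul_le hg hk z (n := m) (mod_cast le_top)).trans ?_
  simp [h _]

theorem Flat.sum {ι : Type*} {u : Finset ι} {g : ι → Z → F} (hg : ∀ i ∈ u, ContDiff ℝ ∞ (g i))
    {z : Z} (h : ∀ i ∈ u, Flat (g i) z) : Flat (fun x => ∑ i ∈ u, g i x) z := by
  intro m
  rw [iteratedFDeriv_sum (fun j hj => (hg j hj).of_le (mod_cast le_top))]
  rw [Finset.sum_apply]
  exact Finset.sum_eq_zero fun i hi => h i hi m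

end

/-! ### Integral curves of time-dependent vector fields -/

theorem lipschitzWith_slice {Z : Type*} [NormedAddCommGroup Z] {v : ℝ × Z → Z} {K : ℝ≥0}
    (hv : LipschitzWith K v) (t : ℝ) : LipschitzWith K fun z => v (t, z) := by
  simpa [Function.comp_def] using hv.comp (LipschitzWith.prodMk_left (β := Z) t)

section
variable {Z : Type*} [NormedAddCommGroup Z] [NormedSpace ℝ Z]

/-- `γ` is an integral curve of the time-dependent vector field `v` on the interval `(A, B)`. -/
def IsTraj (v : ℝ × Z → Z) (A B : ℝ) (γ : ℝ → Z) : Prop :=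
  ∀ t ∈ Ioo A B, HasDerivAt γ (v (t, γ t)) t

theorem IsTraj.continuousAt {v : ℝ × Z → Z} {A B : ℝ} {γ : ℝ → Z} (h : IsTraj v A B γ) {t : ℝ}
    (ht : t ∈ Ioo A B) : ContinuousAt γ t := (h t ht).continuousAt

/-- For a bounded, globally Lipschitz field the ball in Picard-Lindelöf may have radius L times the
length of time, so one application covers the whole interval. -/
theorem exists_isTraj [CompleteSpace Z] {v : ℝ × Z → Z} {K : ℝ≥0} (hv : LipschitzWith K v)
    {L : ℝ} (hL : ∀ p, ‖v p‖ ≤ L) {A B t₀ : ℝ} (ht₀ : t₀ ∈ Ioo A B) (z : Z) :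
    ∃ γ : ℝ → Z, γ t₀ = z ∧ IsTraj v A B γ := by
  have hL0 : 0 ≤ L := (norm_nonneg _).trans (hL (0, 0))
  have hmax : 0 ≤ max (B - t₀) (t₀ - A) := le_max_of_le_left (by linarith [ht₀.2])
  have hpl : IsPicardLindelof (fun t z => v (t, z)) (⟨t₀, ht₀.1.le, ht₀.2.le⟩ : Icc A B) z
      ⟨L * max (B - t₀) (t₀ - A), by positivity⟩ 0 ⟨L, hL0⟩ K :=
    { lipschitzOnWith := fun t _ => (lipschitzWith_slice hv t).lipschitzOnWith
      continuousOn := fun x _ =>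
        (hv.continuous.comp (continuous_id.prodMk continuous_const)).continuousOn
      norm_le := fun t _ x _ => hL _
      mul_max_le := by
        rw [NNReal.coe_zero, sub_zero]
        exact le_refl (L * max (B - t₀) (t₀ - A)) }
  obtain ⟨γ, h0, hγ⟩ := hpl.exists_eq_forall_mem_Icc_hasDerivWithinAt₀
  exact ⟨γ, h0, fun t ht => (hγ t ⟨ht.1.le, ht.2.le⟩).hasDerivAt (Icc_mem_nhds ht.1 ht.2)⟩

theorem IsTraj.dist_le_gronwallBound {v : ℝ × Z → Z} {K : ℝ≥0} (hv : LipschitzWith K v)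
    {A B : ℝ} {γ g g' : ℝ → Z} (hγ : IsTraj v A B γ)
    (hg : ∀ t ∈ Ioo A B, HasDerivAt g (g' t) t) {ε : ℝ} {t₀ t : ℝ} (ht₀ : t₀ ∈ Ioo A B)
    (ht : t ∈ Ioo A B) (hε : ∀ τ ∈ uIcc t₀ t, dist (g' τ) (v (τ, g τ)) ≤ ε) :
    dist (γ t) (g t) ≤ gronwallBound (dist (γ t₀) (g t₀)) K ε |t - t₀| := by
  rcases le_total t₀ t with h | h
  · rw [uIcc_of_le h] at hε
    have hsub : Icc t₀ t ⊆ Ioo A B := fun τ hτ => ⟨ht₀.1.trans_le hτ.1, hτ.2.trans_lt ht.2⟩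
    have := dist_le_of_approx_trajectories_ODE (v := fun t z => v (t, z)) (K := K) (f := γ)
      (f' := fun t => v (t, γ t)) (g := g) (g' := g') (a := t₀) (b := t) (εf := 0) (εg := ε)
      (δ := dist (γ t₀) (g t₀)) (lipschitzWith_slice hv)
      (fun τ hτ => (hγ τ (hsub hτ)).continuousAt.continuousWithinAt)
      (fun τ hτ => (hγ τ (hsub ⟨hτ.1, hτ.2.le⟩)).hasDerivWithinAt)
      (fun τ _ => by simp)
      (fun τ hτ => (hg τ (hsub hτ)).continuousAt.continuousWithinAt)
      (fun τ hτ => (hg τ (hsub ⟨hτ.1, hτ.2.le⟩)).hasDerivWithinAt)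
      (fun τ hτ => hε τ ⟨hτ.1, hτ.2.le⟩) le_rfl t (right_mem_Icc.mpr h)
    simpa [abs_of_nonneg (sub_nonneg.mpr h)] using this
  · rw [uIcc_of_ge h] at hε
    -- Grönwall's inequality runs forward in time, so for t ≤ t₀ both curves are reversed.
    have hsub : ∀ τ ∈ Icc (-t₀) (-t), -τ ∈ Ioo A B := fun τ hτ =>
      ⟨by linarith [ht.1, hτ.2], by linarith [ht₀.2, hτ.1]⟩
    have hneg : ∀ (k : ℝ → Z) (k' : Z) (τ : ℝ), HasDerivAt k k' (-τ) →
        HasDerivAt (fun τ => k (-τ)) (-k') τ := by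
      intro k k' τ hk
      simpa [Function.comp_def] using hk.scomp τ (hasDerivAt_neg τ)
    have := dist_le_of_approx_trajectories_ODE (v := fun t z => -v (-t, z)) (K := K)
      (f := fun τ => γ (-τ)) (f' := fun t => -v (-t, γ (-t))) (g := fun τ => g (-τ))
      (g' := fun τ => -g' (-τ)) (a := -t₀) (b := -t) (εf := 0) (εg := ε)
      (δ := dist (γ t₀) (g t₀)) (fun τ => (lipschitzWith_slice hv (-τ)).neg)
      (fun τ hτ => (hneg _ _ τ (hγ _ (hsub τ hτ))).continuousAt.continuousWithinAt)
      (fun τ hτ => (hneg _ _ τ (hγ _ (hsub τ ⟨hτ.1, hτ.2.le⟩))).hasDerivWithinAt)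
      (fun τ _ => by simp)
      (fun τ hτ => (hneg _ _ τ (hg _ (hsub τ hτ))).continuousAt.continuousWithinAt)
      (fun τ hτ => (hneg _ _ τ (hg _ (hsub τ ⟨hτ.1, hτ.2.le⟩))).hasDerivWithinAt)
      (fun τ hτ => by
        rw [dist_neg_neg]
        exact hε (-τ) ⟨by linarith [hτ.2], by linarith [hτ.1]⟩)
      (by simp) (-t) (right_mem_Icc.mpr (by linarith))
    have habs : |t - t₀| = -t - -t₀ := by rw [abs_of_nonpos (by linarith)]; ring
    simpa [habs] using this

/-- Follows from e^y - 1 ≤ y e^y. Unlike the exact bound, this form needs no case distinction at K =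
0. -/
theorem gronwallBound_le {δ K ε x : ℝ} (hK : 0 ≤ K) (hε : 0 ≤ ε) (hx : 0 ≤ x) :
    gronwallBound δ K ε x ≤ (δ + ε * x) * Real.exp (K * x) := by
  have h1 : 1 ≤ Real.exp (K * x) := Real.one_le_exp (by positivity)
  rcases hK.eq_or_lt with rfl | hK
  · simp [gronwallBound_K0]
  · rw [gronwallBound_of_K_ne_0 hK.ne']
    have h2 : Real.exp (K * x) - 1 ≤ K * x * Real.exp (K * x) := by
      have h3 := Real.add_one_le_exp (-(K * x))
      have h4 : Real.exp (-(K * x)) * Real.exp (K * x) = 1 := by rw [← Real.exp_add]; simp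
      nlinarith [Real.exp_pos (K * x)]
    have h5 : ε / K * (Real.exp (K * x) - 1) ≤ ε / K * (K * x * Real.exp (K * x)) := by gcongr
    have h6 : ε / K * (K * x * Real.exp (K * x)) = ε * x * Real.exp (K * x) := by
      field_simp
    simp only
    linarith

theorem IsTraj.dist_le {v : ℝ × Z → Z} {K : ℝ≥0} (hv : LipschitzWith K v)
    {A B : ℝ} {γ g g' : ℝ → Z} (hγ : IsTraj v A B γ)
    (hg : ∀ t ∈ Ioo A B, HasDerivAt g (g' t) t) {ε : ℝ} {t₀ t : ℝ} (ht₀ : t₀ ∈ Ioo A B)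
    (ht : t ∈ Ioo A B) (hε : ∀ τ ∈ uIcc t₀ t, dist (g' τ) (v (τ, g τ)) ≤ ε) :
    dist (γ t) (g t) ≤ (dist (γ t₀) (g t₀) + ε * |t - t₀|) * Real.exp (K * |t - t₀|) :=
  (hγ.dist_le_gronwallBound hv hg ht₀ ht hε).trans (gronwallBound_le K.2
    (dist_nonneg.trans (hε t₀ left_mem_uIcc)) (abs_nonneg _))

theorem IsTraj.dist_le_of_isTraj {v : ℝ × Z → Z} {K : ℝ≥0} (hv : LipschitzWith K v)
    {A B : ℝ} {γ g : ℝ → Z} (hγ : IsTraj v A B γ) (hg : IsTraj v A B g) {t₀ t : ℝ}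
    (ht₀ : t₀ ∈ Ioo A B) (ht : t ∈ Ioo A B) :
    dist (γ t) (g t) ≤ dist (γ t₀) (g t₀) * Real.exp (K * (B - A)) := by
  have := hγ.dist_le hv hg (ε := 0) ht₀ ht (by simp)
  simp only [zero_mul, add_zero] at this
  refine this.trans ?_
  gcongr
  rw [abs_le]
  constructor <;> linarith [ht₀.1, ht₀.2, ht.1, ht.2]

theorem IsTraj.contDiffOn {v : ℝ × Z → Z} (hv : ContDiff ℝ ∞ v) {A B : ℝ} {γ : ℝ → Z}
    (hγ : IsTraj v A B γ) : ContDiffOn ℝ ∞ γ (Ioo A B) := by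
  have key : ∀ k : ℕ, ContDiffOn ℝ k γ (Ioo A B) := by
    intro k
    induction k with
    | zero =>
      exact contDiffOn_zero.mpr fun t ht => (hγ t ht).continuousAt.continuousWithinAt
    | succ k ih =>
      rw [show ((k + 1 : ℕ) : WithTop ℕ∞) = (k : WithTop ℕ∞) + 1 by push_cast; rfl,
        contDiffOn_succ_iff_deriv_of_isOpen isOpen_Ioo]
      refine ⟨fun t ht => (hγ t ht).differentiableAt.differentiableWithinAt, by simp, ?_⟩
      have h : ContDiffOn ℝ k (fun t => v (t, γ t)) (Ioo A B) :=
        (hv.of_le (mod_cast le_top)).comp_contDiffOn (contDiffOn_id.prodMk ih)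
      exact h.congr fun t ht => (hγ t ht).deriv
  exact contDiffOn_infty.mpr key

/-! ### Invariant sets and sign changes along integral curves -/

/-- Nagumo's theorem: a closed set to which `u` is tangent contains the integral curves of `u` that
start in it. -/
theorem IsTraj.mem_of_tangent [FiniteDimensional ℝ Z] {u : ℝ × Z → Z} {K : ℝ≥0}
    (hu : LipschitzWith K u) {A B T₀ T₁ : ℝ} {e : ℝ → Z} (he : IsTraj u A B e) (hA : A < T₀)
    (hT : T₀ ≤ T₁) (hB : T₁ < B) {S : Set (ℝ × Z)} (hS : IsClosed S) (h0 : (T₀, e T₀) ∈ S)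
    {ρ : ℝ} (hρ : 0 < ρ)
    (htan : ∀ t ∈ Ico T₀ T₁, ∀ z, (t, z) ∈ S → dist z (e t) < ρ → ∀ ε > 0,
      ∀ᶠ h in 𝓝[>] (0 : ℝ), ∃ z', (t + h, z') ∈ S ∧ ‖z' - z - h • u (t, z)‖ ≤ ε * h) :
    (T₁, e T₁) ∈ S := by
  have hsub : Icc T₀ T₁ ⊆ Ioo A B := fun τ hτ => ⟨hA.trans_le hτ.1, hτ.2.trans_lt hB⟩
  have hec : ContinuousOn e (Icc T₀ T₁) :=
    fun t ht => (he.continuousAt (hsub ht)).continuousWithinAt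
  -- A point of S at time T₁ is found within a constant times κ of e T₁; then κ → 0 and S is closed.
  have key : ∀ κ > 0, κ * Real.exp ((K + 1) * (T₁ - T₀)) < ρ →
      ∃ z, (T₁, z) ∈ S ∧ dist z (e T₁) ≤ κ * Real.exp ((K + 1) * (T₁ - T₀)) := by
    intro κ hκ hκρ
    -- The rate K + 1 exceeds the Lipschitz constant by 1. The surplus b h absorbs two errors b h /
    -- 4, one from the tangency of u to S and one from the differentiability of e.
    set b : ℝ → ℝ := fun t => κ * Real.exp ((K + 1) * (t - T₀)) with hb
    have hbc : Continuous b := by fun_prop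
    set Q : Set (ℝ × Z) := {p ∈ Icc T₀ T₁ ×ˢ univ | dist p.2 (e p.1) - b p.1 ≤ 0} ∩ S with hQ
    have hQclosed : IsClosed Q := by
      refine IsClosed.inter ?_ hS
      have hc : ContinuousOn (fun p : ℝ × Z => dist p.2 (e p.1) - b p.1) (Icc T₀ T₁ ×ˢ univ) := by
        have h1 : ContinuousOn (fun p : ℝ × Z => e p.1) (Icc T₀ T₁ ×ˢ univ) :=
          hec.comp continuousOn_fst fun p hp => hp.1
        exact (continuous_dist.comp_continuousOn (continuousOn_snd.prodMk h1)).sub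
          (hbc.comp continuous_fst).continuousOn
      exact hc.preimage_isClosed_of_isClosed (isClosed_Icc.prod isClosed_univ) isClosed_Iic
    obtain ⟨R, hR⟩ := isCompact_Icc.exists_bound_of_continuousOn hec
    have hmem : ∀ {t z}, (t, z) ∈ Q ↔ (t ∈ Icc T₀ T₁ ∧ dist z (e t) ≤ b t) ∧ (t, z) ∈ S := by
      intro t z; simp [hQ]
    have hbT : ∀ t ∈ Icc T₀ T₁, b t ≤ b T₁ := by
      intro t ht
      simp only [hb]
      gcongr
      exact ht.2
    have hQbdd : Bornology.IsBounded Q := by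
      refine Bornology.IsBounded.subset
        ((Metric.isBounded_Icc T₀ T₁).prod (Metric.isBounded_closedBall (x := (0 : Z))
          (r := R + b T₁))) ?_
      rintro ⟨t, z⟩ hz
      obtain ⟨⟨ht, hd⟩, -⟩ := hmem.mp hz
      refine ⟨ht, ?_⟩
      have h1 := hR t ht
      have h2 := hbT t ht
      rw [mem_closedBall_zero_iff]
      have h3 : ‖z‖ ≤ dist z (e t) + ‖e t‖ := by
        rw [dist_eq_norm]
        simpa using norm_add_le (z - e t) (e t)
      linarith
    have hQc : IsCompact Q := by
      have : ProperSpace Z := FiniteDimensional.proper ℝ Z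
      exact Metric.isCompact_of_isClosed_isBounded hQclosed hQbdd
    have hP : IsClosed (Prod.fst '' Q ∩ Icc T₀ T₁) :=
      (hQc.image continuous_fst).isClosed.inter isClosed_Icc
    -- Continuous induction: the times reached by Q form a closed set that contains T₀ and extends
    -- to the right of each of its points before T₁.
    have hall := hP.Icc_subset_of_forall_exists_gt
      ⟨(T₀, e T₀), hmem.mpr ⟨⟨⟨le_rfl, hT⟩, by simp [hb, hκ.le]⟩, h0⟩, rfl⟩ (by
        rintro t ⟨⟨⟨t', z⟩, hz, rfl⟩, ht⟩ y hy
        dsimp only at ht hy ⊢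
        obtain ⟨⟨ht', hd⟩, hzS⟩ := hmem.mp hz
        have hbpos : 0 < b t' := by positivity
        have h1 := htan t' ht z hzS (hd.trans_lt ((hbT _ ht').trans_lt hκρ)) (b t' / 4)
          (by positivity)
        have h2 : ∀ᶠ h in 𝓝[>] (0 : ℝ), ‖e (t' + h) - e t' - h • u (t', e t')‖ ≤ b t' / 4 * h := by
          have := (Asymptotics.isLittleO_iff.mp (hasDerivAt_iff_isLittleO_nhds_zero.mp
            (he t' (hsub ht')))) (show 0 < b t' / 4 by positivity)
          filter_upwards [nhdsWithin_le_nhds this, self_mem_nhdsWithin] with h hh hpos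
          simpa [abs_of_pos (show (0 : ℝ) < h from hpos)] using hh
        have hlim : ∀ᶠ h in 𝓝[>] (0 : ℝ), h < min (y - t') (T₁ - t') :=
          nhdsWithin_le_nhds (gt_mem_nhds (lt_min (sub_pos.mpr hy) (sub_pos.mpr ht.2)))
        obtain ⟨h, ⟨z', hz'S, hz'⟩, he', hlt, hpos⟩ :=
          (h1.and (h2.and (hlim.and self_mem_nhdsWithin))).exists
        have hpos : 0 < h := hpos
        have hlt1 := hlt.trans_le (min_le_left _ _)
        have hlt2 := hlt.trans_le (min_le_right _ _)
        refine ⟨t' + h, ⟨(t' + h, z'), hmem.mpr ⟨⟨⟨by linarith [ht.1], by linarith⟩, ?_⟩, hz'S⟩,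
          rfl⟩, by simpa using hpos, by linarith⟩
        have hlip : ‖u (t', z) - u (t', e t')‖ ≤ K * b t' := by
          rw [← dist_eq_norm]
          exact ((lipschitzWith_slice hu t').dist_le_mul z (e t')).trans (by gcongr)
        have hsplit : z' - e (t' + h) = (z' - z - h • u (t', z)) -
            (e (t' + h) - e t' - h • u (t', e t')) + (z - e t') +
            h • (u (t', z) - u (t', e t')) := by
          rw [smul_sub]; abel
        have hexp : b t' * (1 + (K + 1) * h) ≤ b (t' + h) := by
          have : b (t' + h) = b t' * Real.exp ((K + 1) * h) := by
            simp only [hb]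
            rw [mul_assoc, ← Real.exp_add]
            ring_nf
          rw [this]
          gcongr
          linarith [Real.add_one_le_exp ((K + 1 : ℝ) * h)]
        rw [dist_eq_norm, hsplit]
        have hn : ‖h • (u (t', z) - u (t', e t'))‖ ≤ h * (K * b t') := by
          rw [norm_smul, Real.norm_eq_abs, abs_of_pos hpos]
          gcongr
        rw [dist_eq_norm] at hd
        have := norm_add_le ((z' - z - h • u (t', z)) -
            (e (t' + h) - e t' - h • u (t', e t')) + (z - e t')) (h • (u (t', z) - u (t', e t')))
        have := norm_add_le ((z' - z - h • u (t', z)) -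
            (e (t' + h) - e t' - h • u (t', e t'))) (z - e t')
        have := norm_sub_le (z' - z - h • u (t', z)) (e (t' + h) - e t' - h • u (t', e t'))
        nlinarith [mul_pos hbpos hpos])
    obtain ⟨⟨t, z⟩, hz, rfl⟩ := hall ⟨hT, le_rfl⟩
    obtain ⟨⟨-, hd⟩, hzS⟩ := hmem.mp hz
    exact ⟨z, hzS, hd⟩
  have hE := Real.exp_pos ((K + 1) * (T₁ - T₀))
  set E := Real.exp ((K + 1) * (T₁ - T₀)) with hEdef
  rw [← hS.closure_eq, Metric.mem_closure_iff]
  intro ε hε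
  obtain ⟨z, hz, hd⟩ := key (min ε ρ / (2 * E)) (by positivity) (by
    rw [div_mul_eq_mul_div, div_lt_iff₀ (by positivity)]
    nlinarith [min_le_right ε ρ, mul_pos hρ hE])
  refine ⟨(T₁, z), hz, ?_⟩
  rw [Prod.dist_eq, dist_self, dist_comm]
  refine max_lt hε (hd.trans_lt ?_)
  rw [div_mul_eq_mul_div, div_lt_iff₀ (by positivity)]
  nlinarith [min_le_left ε ρ, mul_pos hε hE]

theorem eventually_pos_of_fderiv_pos {ψ : ℝ × Z → ℝ} {t : ℝ} {z q : Z}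
    (hψ : DifferentiableAt ℝ ψ (t, z)) (h0 : ψ (t, z) = 0) (h1 : 0 < fderiv ℝ ψ (t, z) (1, q)) :
    ∀ᶠ h in 𝓝[>] (0 : ℝ), 0 < ψ (t + h, z + h • q) := by
  have hline : HasDerivAt (fun h : ℝ => ((t, z) : ℝ × Z) + h • ((1, q) : ℝ × Z)) (1, q) 0 := by
    simpa using ((hasDerivAt_id (0 : ℝ)).smul_const ((1, q) : ℝ × Z)).const_add ((t, z) : ℝ × Z)
  have hψ' : HasFDerivAt ψ (fderiv ℝ ψ (t, z)) (((t, z) : ℝ × Z) + (0 : ℝ) • ((1, q) : ℝ × Z)) := by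
    simpa using hψ.hasFDerivAt
  have hd := hψ'.comp_hasDerivAt 0 hline
  have := (hasDerivAt_iff_tendsto_slope.mp hd).eventually_const_lt h1
  have h2 : ∀ᶠ h in 𝓝[>] (0 : ℝ), 0 < slope (ψ ∘ fun h : ℝ => ((t, z) : ℝ × Z) +
      h • ((1, q) : ℝ × Z)) 0 h := this.filter_mono (nhdsWithin_mono _ fun x hx => ne_of_gt hx)
  filter_upwards [h2, self_mem_nhdsWithin] with h hh hpos
  rw [slope_def_field] at hh
  have hpos : 0 < h := hpos
  rw [div_pos_iff_of_pos_right (by simpa using hpos)] at hh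
  simpa [h0] using hh

/-- If `ψ` changes sign from `+` to `-` along an integral curve of `u`, then it does so along a
nearby integral curve of `v`, provided that `ψ` is nondecreasing along `u` at its zeros, and
that `u = v` where `ψ` and its `z`-derivative vanish. -/
theorem exists_isTraj_sign_change [FiniteDimensional ℝ Z] {u v : ℝ × Z → Z} {K K' : ℝ≥0}
    (hu : LipschitzWith K u) (hv : LipschitzWith K' v) {L : ℝ} (hL : ∀ p, ‖v p‖ ≤ L)
    {ψ : ℝ × Z → ℝ} (hψ : ContDiff ℝ 1 ψ) {A B T₀ T₁ : ℝ} {e : ℝ → Z} (he : IsTraj u A B e)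
    (hA : A < T₀) (hT : T₀ ≤ T₁) (hB : T₁ < B) {ρ : ℝ} (hρ : 0 < ρ)
    (hmono : ∀ t ∈ Icc T₀ T₁, ∀ z, dist z (e t) < ρ → ψ (t, z) = 0 →
      0 ≤ fderiv ℝ ψ (t, z) (1, u (t, z)))
    (huv : ∀ t ∈ Icc T₀ T₁, ∀ z, dist z (e t) < ρ → ψ (t, z) = 0 →
      (∀ q, fderiv ℝ ψ (t, z) (0, q) = 0) → v (t, z) = u (t, z))
    (hpos : 0 < ψ (T₀, e T₀)) (hneg : ψ (T₁, e T₁) < 0) :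
    ∃ γ, IsTraj v A B γ ∧ ∃ s ∈ Icc T₀ T₁, ∃ t ∈ Icc T₀ T₁, s < t ∧ dist (γ s) (e s) < ρ ∧
      0 < ψ (s, γ s) ∧ ψ (t, γ t) < 0 := by
  have : CompleteSpace Z := FiniteDimensional.complete ℝ Z
  by_contra hcon
  push Not at hcon
  have hsub : Icc T₀ T₁ ⊆ Ioo A B := fun τ hτ => ⟨hA.trans_le hτ.1, hτ.2.trans_lt hB⟩
  -- The points from which ψ stays nonnegative along v up to T₁. If no curve of v has the sign
  -- change, S contains all points near e with ψ > 0. Once S is closed and u is tangent to it,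
  -- Nagumo's theorem gives ψ ≥ 0 at the end of e.
  set S : Set (ℝ × Z) := {p | p.1 ∈ Icc T₀ T₁ ∧ ∃ γ, IsTraj v A B γ ∧ γ p.1 = p.2 ∧
    ∀ τ ∈ Icc p.1 T₁, 0 ≤ ψ (τ, γ τ)} with hSdef
  have hψc := hψ.continuous
  have hpos_mem : ∀ t ∈ Icc T₀ T₁, ∀ z, dist z (e t) < ρ → 0 < ψ (t, z) → (t, z) ∈ S := by
    intro t ht z hd hz
    obtain ⟨γ, hγ0, hγ⟩ := exists_isTraj hv hL (hsub ht) z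
    refine ⟨ht, γ, hγ, hγ0, fun τ hτ => ?_⟩
    dsimp only at hτ
    rcases hτ.1.eq_or_lt with rfl | hlt
    · rw [hγ0]; exact hz.le
    · exact hcon γ hγ t ht τ ⟨ht.1.trans hτ.1, hτ.2⟩ hlt (by rwa [hγ0]) (by rwa [hγ0])
  have hS : IsClosed S := by
    rw [← isSeqClosed_iff_isClosed]
    rintro p ⟨t, z⟩ hp hlim
    have hlim1 : Tendsto (fun k => (p k).1) atTop (𝓝 t) :=
      (continuous_fst.tendsto _).comp hlim
    have hlim2 : Tendsto (fun k => (p k).2) atTop (𝓝 z) :=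
      (continuous_snd.tendsto _).comp hlim
    have ht : t ∈ Icc T₀ T₁ := isClosed_Icc.mem_of_tendsto hlim1 (Eventually.of_forall
      fun k => (hp k).1)
    obtain ⟨γ, hγ0, hγ⟩ := exists_isTraj hv hL (hsub ht) z
    refine ⟨ht, γ, hγ, hγ0, fun τ hτ => ?_⟩
    dsimp only at hτ hγ0
    have hτ' : τ ∈ Icc T₀ T₁ := ⟨ht.1.trans hτ.1, hτ.2⟩
    choose hpt g hg hg0 hgψ using hp
    -- The curve `g k` is controlled only from time `(p k).1` on, which may exceed τ; the maximum of
    -- the two times is admissible and converges to τ.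
    have hm : Tendsto (fun k => max τ (p k).1) atTop (𝓝 τ) := by
      have := (tendsto_const_nhds (x := τ)).max hlim1
      rwa [max_eq_left hτ.1] at this
    have hmI : ∀ k, max τ (p k).1 ∈ Icc T₀ T₁ := fun k =>
      ⟨hτ'.1.trans (le_max_left _ _), max_le hτ'.2 (hpt k).2⟩
    have hconv : Tendsto (fun k => g k (max τ (p k).1)) atTop (𝓝 (γ τ)) := by
      rw [tendsto_iff_dist_tendsto_zero]
      have hb : ∀ k, dist (g k (max τ (p k).1)) (γ τ) ≤
          dist (p k).2 (γ (p k).1) * Real.exp (K' * (B - A)) +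
            dist (γ (max τ (p k).1)) (γ τ) := by
        intro k
        refine (dist_triangle _ (γ (max τ (p k).1)) _).trans ?_
        gcongr
        rw [← hg0 k]
        exact (hg k).dist_le_of_isTraj hv hγ (hsub (hpt k)) (hsub (hmI k))
      have hc1 : Tendsto (fun k => γ (p k).1) atTop (𝓝 z) := by
        rw [← hγ0]
        exact (hγ.continuousAt (hsub ht)).tendsto.comp hlim1
      have hc2 : Tendsto (fun k => γ (max τ (p k).1)) atTop (𝓝 (γ τ)) :=
        (hγ.continuousAt (hsub hτ')).tendsto.comp hm
      have h0 : Tendsto (fun k => dist (p k).2 (γ (p k).1) * Real.exp (K' * (B - A)) +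
            dist (γ (max τ (p k).1)) (γ τ)) atTop (𝓝 0) := by
        have := ((hlim2.dist hc1).mul_const (Real.exp (K' * (B - A)))).add
          (hc2.dist (tendsto_const_nhds (x := γ τ)))
        simpa using this
      exact squeeze_zero (fun k => dist_nonneg) hb h0
    have hfin : Tendsto (fun k => ψ (max τ (p k).1, g k (max τ (p k).1))) atTop
        (𝓝 (ψ (τ, γ τ))) := (hψc.tendsto _).comp (hm.prodMk_nhds hconv)
    exact ge_of_tendsto' hfin fun k => hgψ k _ ⟨le_max_right _ _, (hmI k).2⟩
  have hnear : ∀ t ∈ Ico T₀ T₁, ∀ z, dist z (e t) < ρ → ∀ q : Z, ∀ᶠ h in 𝓝[>] (0 : ℝ),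
      t + h ∈ Icc T₀ T₁ ∧ dist (z + h • q) (e (t + h)) < ρ := by
    intro t ht z hz q
    have h1 : ∀ᶠ h in 𝓝[>] (0 : ℝ), h < T₁ - t :=
      nhdsWithin_le_nhds (gt_mem_nhds (sub_pos.mpr ht.2))
    have hc : ContinuousAt (fun h : ℝ => dist (z + h • q) (e (t + h))) 0 := by
      have h2 : ContinuousAt e (t + 0) := by
        rw [add_zero]; exact he.continuousAt (hsub ⟨ht.1, ht.2.le⟩)
      have h3 : ContinuousAt (fun h : ℝ => e (t + h)) 0 :=
        ContinuousAt.comp (f := fun h : ℝ => t + h) h2 (by fun_prop)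
      have h4 : ContinuousAt (fun h : ℝ => z + h • q) 0 := by fun_prop
      exact Filter.Tendsto.dist h4 h3
    have h2 : ∀ᶠ h in 𝓝[>] (0 : ℝ), dist (z + h • q) (e (t + h)) < ρ :=
      nhdsWithin_le_nhds (hc.eventually_lt_const (by simpa using hz))
    filter_upwards [h1, h2, self_mem_nhdsWithin] with h hh1 hh2 hpos
    have hpos : 0 < h := hpos
    exact ⟨⟨by linarith [ht.1], by linarith⟩, hh2⟩
  have hfinal := he.mem_of_tangent hu hA hT hB hS
    (hpos_mem T₀ ⟨le_rfl, hT⟩ _ (by simpa using hρ) hpos) hρ (by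
      intro t ht z hzS hd ε hε
      have htI : t ∈ Icc T₀ T₁ := ⟨ht.1, ht.2.le⟩
      obtain ⟨-, γ, hγ, hγz, hγψ⟩ := hzS
      dsimp only at hγz hγψ
      have hz0 : 0 ≤ ψ (t, z) := by
        have := hγψ t ⟨le_rfl, htI.2⟩
        rwa [hγz] at this
      rcases hz0.lt_or_eq with hzpos | hzero
      · have hc : ContinuousAt (fun h : ℝ => ψ (t + h, z + h • u (t, z))) 0 := by fun_prop
        have h1 : ∀ᶠ h in 𝓝[>] (0 : ℝ), 0 < ψ (t + h, z + h • u (t, z)) :=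
          nhdsWithin_le_nhds (hc.eventually_const_lt (by simpa using hzpos))
        filter_upwards [h1, hnear t ht z hd (u (t, z)), self_mem_nhdsWithin] with h hh1 hh2 hpos
        refine ⟨_, hpos_mem _ hh2.1 _ hh2.2 hh1, ?_⟩
        have hpos : 0 < h := hpos
        simp only [add_sub_cancel_left, sub_self, norm_zero]
        positivity
      · by_cases hq : ∀ q, fderiv ℝ ψ (t, z) (0, q) = 0
        -- Here u = v, so the curve of v through the point, which remains in S, has the velocity u.
        · have hder := hγ t (hsub htI)
          rw [hγz, huv t htI z hd hzero.symm hq] at hder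
          have := (Asymptotics.isLittleO_iff.mp (hasDerivAt_iff_isLittleO_nhds_zero.mp hder)) hε
          filter_upwards [nhdsWithin_le_nhds this, self_mem_nhdsWithin,
            hnear t ht z hd 0] with h hh hpos hI
          have hpos : 0 < h := hpos
          refine ⟨γ (t + h), ⟨hI.1, γ, hγ, rfl, fun τ hτ => hγψ τ ⟨?_, hτ.2⟩⟩, ?_⟩
          · have := hτ.1
            dsimp only at this
            linarith
          · simpa [abs_of_pos hpos, hγz] using hh
        · push Not at hq
          obtain ⟨q, hq⟩ := hq
          obtain ⟨q, hq⟩ : ∃ q, 0 < fderiv ℝ ψ (t, z) (0, q) := by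
            rcases hq.lt_or_gt with h | h
            · refine ⟨-q, ?_⟩
              have : ((0, -q) : ℝ × Z) = -(0, q) := by simp
              rw [this, map_neg]
              linarith
            · exact ⟨q, h⟩
          -- Along u + c q the function ψ increases to first order, so it becomes positive at once;
          -- c is small enough that the correction costs at most ε h.
          set c := ε / (‖q‖ + 1) with hc
          have hcpos : 0 < c := by positivity
          have hd1 : 0 < fderiv ℝ ψ (t, z) (1, u (t, z) + c • q) := by
            have : ((1, u (t, z) + c • q) : ℝ × Z) = (1, u (t, z)) + c • (0, q) := by simp
            rw [this, map_add, map_smul, smul_eq_mul]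
            have := hmono t htI z hd hzero.symm
            have := mul_pos hcpos hq
            linarith
          filter_upwards [eventually_pos_of_fderiv_pos
            (hψ.differentiable one_ne_zero _) hzero.symm hd1,
            hnear t ht z hd (u (t, z) + c • q), self_mem_nhdsWithin] with h hh1 hh2 hpos
          refine ⟨_, hpos_mem _ hh2.1 _ hh2.2 hh1, ?_⟩
          have hpos : 0 < h := hpos
          have : z + h • (u (t, z) + c • q) - z - h • u (t, z) = (h * c) • q := by
            rw [smul_add, smul_smul]; abel
          rw [this, norm_smul, Real.norm_eq_abs, abs_of_pos (by positivity)]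
          have hcq : c * ‖q‖ ≤ ε := by
            rw [hc, div_mul_eq_mul_div, div_le_iff₀ (by positivity)]
            nlinarith [norm_nonneg q]
          nlinarith)
  obtain ⟨-, γ, hγ, hγz, hγψ⟩ := hfinal
  dsimp only at hγz hγψ
  have := hγψ T₁ ⟨le_rfl, le_rfl⟩
  rw [hγz] at this
  linarith

end

/-! ### Multi-indices and the polynomial part of the phase -/

/-- Euclidean space of dimension `n`. -/
abbrev Sp (n : ℕ) := EuclideanSpace ℝ (Fin n)

/-- The multi-indices of length between `2` and `K`. -/
def idx (n K : ℕ) : Finset (Fin n → ℕ) :=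
  (Finset.Icc 2 K).biUnion fun k => Finset.piAntidiag Finset.univ k

theorem mem_idx {n K : ℕ} {α : Fin n → ℕ} : α ∈ idx n K ↔ 2 ≤ ∑ i, α i ∧ ∑ i, α i ≤ K := by
  simp [idx]

theorem sum_idx {n K : ℕ} {M : Type*} [AddCommMonoid M] (g : (Fin n → ℕ) → M) :
    ∑ α ∈ idx n K, g α = ∑ k ∈ Finset.Icc 2 K, ∑ α ∈ Finset.piAntidiag Finset.univ k, g α := by
  rw [idx, Finset.sum_biUnion]
  intro i _ j _ hij
  exact Finset.disjoint_left.mpr fun α h1 h2 => hij (by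
    rw [Finset.mem_piAntidiag] at h1 h2
    exact h1.1.symm.trans h2.1)

/-- The monomial `s ^ β`, as a complex number. -/
noncomputable def mon {n : ℕ} (β : Fin n → ℕ) (s : Sp n) : ℂ := ∏ j, ((s j : ℝ) : ℂ) ^ β j

theorem contDiff_mon {n : ℕ} (β : Fin n → ℕ) : ContDiff ℝ ∞ (mon β) := by
  unfold mon
  refine contDiff_prod fun j _ => ContDiff.pow ?_ _
  exact Complex.ofRealCLM.contDiff.comp (EuclideanSpace.proj (𝕜 := ℝ) j).contDiff

theorem mon_zero {n : ℕ} (β : Fin n → ℕ) : mon β 0 = if β = 0 then 1 else 0 := by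
  split_ifs with h
  · simp [mon, h]
  · obtain ⟨j, hj⟩ := Function.ne_iff.mp h
    exact Finset.prod_eq_zero (Finset.mem_univ j) (by simpa using hj)

/-- Subtraction of multi-indices is truncated; where β j = 0 the factor β j removes the term. -/
theorem hasFDerivAt_mon {n : ℕ} (β : Fin n → ℕ) (s : Sp n) :
    HasFDerivAt (mon β) (∑ j, ((β j : ℂ) * mon (β - Pi.single j 1) s) •
      (Complex.ofRealCLM.comp (EuclideanSpace.proj (𝕜 := ℝ) j : Sp n →L[ℝ] ℝ))) s := by
  have h1 : ∀ j : Fin n, HasFDerivAt (fun s : Sp n => ((s j : ℝ) : ℂ))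
      (Complex.ofRealCLM.comp (EuclideanSpace.proj (𝕜 := ℝ) j : Sp n →L[ℝ] ℝ)) s := fun j =>
    (Complex.ofRealCLM.comp (EuclideanSpace.proj (𝕜 := ℝ) j : Sp n →L[ℝ] ℝ)).hasFDerivAt
  have h2 := HasFDerivAt.finsetProd (u := Finset.univ) (x := s)
    (g := fun j (s : Sp n) => ((s j : ℝ) : ℂ) ^ β j) fun j _ => (h1 j).pow (β j)
  refine h2.congr_fderiv (Finset.sum_congr rfl fun j _ => ?_)
  rw [smul_smul]
  congr 1
  rw [mon, ← Finset.mul_prod_erase _ _ (Finset.mem_univ j)]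
  have : ∏ l ∈ Finset.univ.erase j, ((s l : ℝ) : ℂ) ^ (β - Pi.single j 1 : Fin n → ℕ) l =
      ∏ l ∈ Finset.univ.erase j, ((s l : ℝ) : ℂ) ^ β l :=
    Finset.prod_congr rfl fun l hl => by simp [Finset.ne_of_mem_erase hl]
  rw [this]
  simp
  ring

/-- The multi-index factorial `α!`. -/
def mfact {n : ℕ} (α : Fin n → ℕ) : ℕ := ∏ j, (α j)!

theorem mfact_ne_zero {n : ℕ} (α : Fin n → ℕ) : (mfact α : ℂ) ≠ 0 :=
  Nat.cast_ne_zero.mpr (Finset.prod_ne_zero_iff.mpr fun _ _ => Nat.factorial_ne_zero _)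

/-- The polynomial `∑ w_α s^α / α!` over `2 ≤ |α| ≤ K`. -/
noncomputable def poly {n : ℕ} (K : ℕ) (w : (Fin n → ℕ) → ℂ) (s : Sp n) : ℂ :=
  ∑ α ∈ idx n K, w α * mon α s / mfact α

/-- The gradient of `poly`. -/
noncomputable def gradPoly {n : ℕ} (K : ℕ) (w : (Fin n → ℕ) → ℂ) (s : Sp n) (j : Fin n) : ℂ :=
  ∑ α ∈ idx n K, w α * ((α j : ℂ) * mon (α - Pi.single j 1) s) / mfact α

theorem phase_eq {n K : ℕ} (w₀ : ℝ → ℂ) (x₀ ξ₀ : ℝ → Sp n) (w : (Fin n → ℕ) → ℝ → ℂ) (t : ℝ)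
    (x : Sp n) : phase K w₀ x₀ ξ₀ w t x =
      w₀ t + ((inner ℝ (x - x₀ t) (ξ₀ t) : ℝ) : ℂ) + poly K (fun α => w α t) (x - x₀ t) := by
  simp only [phase, poly, sum_idx]
  rfl

theorem hasFDerivAt_poly {n K : ℕ} (w : (Fin n → ℕ) → ℂ) (s : Sp n) :
    HasFDerivAt (poly K w) (∑ j, gradPoly K w s j •
      (Complex.ofRealCLM.comp (EuclideanSpace.proj (𝕜 := ℝ) j : Sp n →L[ℝ] ℝ))) s := by
  have h := HasFDerivAt.fun_sum (u := idx n K) (x := s)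
    (A := fun α s => w α / mfact α * mon α s)
    fun α _ => (hasFDerivAt_mon α s).const_mul (w α / mfact α)
  have hp : poly K w = fun s => ∑ α ∈ idx n K, w α / mfact α * mon α s := by
    funext s
    exact Finset.sum_congr rfl fun α _ => by ring
  rw [hp]
  refine h.congr_fderiv ?_
  ext v
  simp only [gradPoly, _root_.sum_apply, _root_.smul_apply, smul_eq_mul, Finset.sum_mul,
    Finset.mul_sum]
  rw [Finset.sum_comm]
  refine Finset.sum_congr rfl fun j _ => Finset.sum_congr rfl fun α _ => ?_
  ring

/-- Since |α| ≥ 2, one derivative leaves no constant term. Hence the gradient of P is O(|s|), which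
controls the truncation errors below. -/
theorem ne_zero_of_mem_idx {n K : ℕ} {α : Fin n → ℕ} (h : α ∈ idx n K) (j : Fin n) (hj : α j ≠ 0) :
    α - Pi.single j 1 ≠ 0 := by
  intro h0
  have h1 : α = Pi.single j 1 := by
    funext l
    have := congrFun h0 l
    by_cases hl : l = j
    · subst hl; simp at this ⊢; omega
    · simp [hl] at this ⊢; omega
  have := (mem_idx.mp h).1
  rw [h1] at this
  simp at this

theorem gradPoly_zero {n K : ℕ} (w : (Fin n → ℕ) → ℂ) (j : Fin n) : gradPoly K w 0 j = 0 := by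
  refine Finset.sum_eq_zero fun α hα => ?_
  by_cases hj : α j = 0
  · simp [hj]
  · simp [mon_zero, ne_zero_of_mem_idx hα j hj]

/-- Both sides are 2 if i = j and 1 otherwise. The right side is the factor that ∂_j brings down
from s^α, so it cancels the division by α!. -/
theorem mfact_single_add_single {n : ℕ} (i j : Fin n) :
    mfact (Pi.single i 1 + Pi.single j 1 : Fin n → ℕ) =
      (Pi.single i 1 + Pi.single j 1 : Fin n → ℕ) j := by
  rw [mfact, Finset.prod_eq_single j]
  · by_cases h : i = j
    · subst h; simp
    · simp [Ne.symm h]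
  · intro l _ hl
    by_cases h : i = l
    · subst h; simp [hl]
    · simp [hl, Ne.symm h]
  · simp

theorem single_add_single_mem_idx {n K : ℕ} (hK : 2 ≤ K) (i j : Fin n) :
    (Pi.single i 1 + Pi.single j 1 : Fin n → ℕ) ∈ idx n K := by
  rw [mem_idx]
  simp [Finset.sum_add_distrib, hK]

/-- The second order part of the coefficients, as a symmetric matrix. -/
def hess {n : ℕ} (w : (Fin n → ℕ) → ℂ) (i j : Fin n) : ℂ := w (Pi.single i 1 + Pi.single j 1)

/-- At s = 0 only α = e_i + e_j survives the two derivatives ∂_i ∂_j. -/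
theorem hasDerivAt_gradPoly_line {n K : ℕ} (hK : 2 ≤ K) (w : (Fin n → ℕ) → ℂ) (s : Sp n)
    (j : Fin n) :
    HasDerivAt (fun τ : ℝ => gradPoly K w (τ • s) j) (∑ i, hess w i j * s i) 0 := by
  have hline : HasDerivAt (fun τ : ℝ => τ • s) s 0 := by
    simpa using (hasDerivAt_id (0 : ℝ)).smul_const s
  have hmon : ∀ β : Fin n → ℕ, HasDerivAt (fun τ : ℝ => mon β (τ • s))
      (∑ i, (β i : ℂ) * mon (β - Pi.single i 1) 0 * s i) 0 := by
    intro β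
    have h1 : HasFDerivAt (mon β) _ ((0 : ℝ) • s) := hasFDerivAt_mon β _
    have := h1.comp_hasDerivAt 0 hline
    simpa [Function.comp_def, _root_.sum_apply] using this
  have h := HasDerivAt.fun_sum (u := idx n K) (x := (0 : ℝ))
    (A := fun α (τ : ℝ) => w α * ((α j : ℂ) * mon (α - Pi.single j 1) (τ • s)) / mfact α)
    fun α _ => (((hmon (α - Pi.single j 1)).const_mul (α j : ℂ)).const_mul (w α)).div_const
      (mfact α : ℂ)
  refine h.congr_deriv ?_
  simp only [Finset.mul_sum, Finset.sum_div]
  rw [Finset.sum_comm]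
  refine Finset.sum_congr rfl fun i _ => ?_
  rw [Finset.sum_eq_single (Pi.single i 1 + Pi.single j 1)]
  · rw [mfact_single_add_single, hess]
    have hne : (((Pi.single i 1 + Pi.single j 1 : Fin n → ℕ) j : ℕ) : ℂ) ≠ 0 := by
      rw [Nat.cast_ne_zero]; simp
    rw [add_tsub_cancel_right, tsub_self, mon_zero, if_pos rfl]
    field_simp
    simp
  · intro α _ hα
    by_cases h1 : α j = 0
    · simp [h1]
    by_cases h2 : (α - Pi.single j 1 : Fin n → ℕ) i = 0
    · simp [h2]
    have h3 : α - Pi.single j 1 - Pi.single i 1 ≠ 0 := by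
      intro h0
      apply hα
      funext l
      have h4 := congrFun h0 l
      simp only [Pi.sub_apply, Pi.add_apply, Pi.zero_apply] at h4 h2 ⊢
      by_cases hl : l = j <;> by_cases hi : l = i
      · subst hl; subst hi; simp at *; omega
      · subst hl; simp [hi, Ne.symm hi] at *; omega
      · subst hi; simp [hl] at *; omega
      · simp [hl, hi] at *; omega
    simp [mon_zero, h3]
  · intro h0
    exact absurd (single_add_single_mem_idx hK i j) h0

/-- The space of coefficients `w_α`, `2 ≤ |α| ≤ K`. -/
abbrev Coef (n K : ℕ) := ↥(idx n K) → ℂ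

/-- Extension of a family of coefficients by zero. -/
noncomputable def ext {n K : ℕ} (w : Coef n K) (α : Fin n → ℕ) : ℂ :=
  if h : α ∈ idx n K then w ⟨α, h⟩ else 0

theorem contDiff_ext {n K : ℕ} (α : Fin n → ℕ) : ContDiff ℝ ∞ fun w : Coef n K => ext w α := by
  unfold ext
  split_ifs with h
  · fun_prop
  · exact contDiff_const

theorem ext_restrict {n K : ℕ} (w : (Fin n → ℕ) → ℂ) {α : Fin n → ℕ} (h : α ∈ idx n K) :
    ext (fun β : ↥(idx n K) => w β) α = w α := by simp [ext, h]

theorem poly_congr {n K : ℕ} {w w' : (Fin n → ℕ) → ℂ} (h : ∀ α ∈ idx n K, w α = w' α) (s : Sp n) :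
    poly K w s = poly K w' s :=
  Finset.sum_congr rfl fun α hα => by rw [h α hα]

theorem contDiff_gradPoly {n K : ℕ} {P : Type*} [NormedAddCommGroup P] [NormedSpace ℝ P]
    {w : P → Coef n K} {s : P → Sp n} (hw : ContDiff ℝ ∞ w) (hs : ContDiff ℝ ∞ s) (j : Fin n) :
    ContDiff ℝ ∞ fun p => gradPoly K (ext (w p)) (s p) j := by
  unfold gradPoly
  refine ContDiff.sum fun α _ => ?_
  exact (((contDiff_ext α).comp hw).mul (contDiff_const.mul ((contDiff_mon _).comp hs))).div_const _

/-! ### The Taylor expansion of the symbol -/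

/-- The partial derivative `∂_{ξ_{j₁}} ⋯ ∂_{ξ_{j_k}} f`. -/
noncomputable def symbCoef {n k : ℕ} (f : ℝ × Sp n × Sp n → ℝ) (j : Fin k → Fin n)
    (p : ℝ × Sp n × Sp n) : ℝ :=
  iteratedFDeriv ℝ k f p fun i => (0, 0, EuclideanSpace.single (j i) 1)

theorem contDiff_symbCoef {n k : ℕ} {f : ℝ × Sp n × Sp n → ℝ} (hf : ContDiff ℝ ∞ f)
    (j : Fin k → Fin n) : ContDiff ℝ ∞ (symbCoef f j) :=
  contDiff_iteratedFDeriv_apply hf k contDiff_id _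

/-- Derivatives in ξ alone become derivatives of f in all variables in the directions (0, 0, e_j),
which makes the coefficients jointly smooth in (t, x, ξ). -/
theorem symbolTaylor_eq {n : ℕ} {f : ℝ × Sp n × Sp n → ℝ} (hf : ContDiff ℝ ∞ f) (N : ℕ) (t : ℝ)
    (x ξ : Sp n) (σ : Fin n → ℂ) :
    symbolTaylor N f t x ξ σ = ∑ k ∈ Finset.range (N + 1), ((k ! : ℕ) : ℂ)⁻¹ *
      ∑ j : Fin k → Fin n, ((symbCoef f j (t, x, ξ) : ℝ) : ℂ) * ∏ i, σ (j i) := by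
  unfold symbolTaylor
  refine Finset.sum_congr rfl fun k _ => ?_
  congr 1
  refine Finset.sum_congr rfl fun j _ => ?_
  have := iteratedFDeriv_comp_affine hf ((ContinuousLinearMap.inr ℝ ℝ (Sp n × Sp n)).comp
    (ContinuousLinearMap.inr ℝ (Sp n) (Sp n))) (t, x, 0) k ξ
  simp only [ContinuousLinearMap.comp_apply, ContinuousLinearMap.inr_apply, Prod.mk_add_mk,
    add_zero, zero_add] at this
  rw [this]
  rfl

theorem contDiff_symbolTaylor {n : ℕ} {f : ℝ × Sp n × Sp n → ℝ} (hf : ContDiff ℝ ∞ f) (N : ℕ)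
    {P : Type*} [NormedAddCommGroup P] [NormedSpace ℝ P] {t : P → ℝ} {x ξ : P → Sp n}
    {σ : P → Fin n → ℂ} (ht : ContDiff ℝ ∞ t) (hx : ContDiff ℝ ∞ x) (hξ : ContDiff ℝ ∞ ξ)
    (hσ : ∀ j, ContDiff ℝ ∞ fun p => σ p j) :
    ContDiff ℝ ∞ fun p => symbolTaylor N f (t p) (x p) (ξ p) (σ p) := by
  simp only [symbolTaylor_eq hf]
  refine ContDiff.sum fun k _ => contDiff_const.mul (ContDiff.sum fun j _ => ContDiff.mul ?_ ?_)
  · exact Complex.ofRealCLM.contDiff.comp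
      ((contDiff_symbCoef hf j).comp (ht.prodMk (hx.prodMk hξ)))
  · exact contDiff_prod fun i _ => hσ (j i)

theorem symbolTaylor_zero {n : ℕ} (f : ℝ × Sp n × Sp n → ℝ) (N : ℕ) (t : ℝ) (x ξ : Sp n) :
    symbolTaylor N f t x ξ (fun _ => 0) = f (t, x, ξ) := by
  unfold symbolTaylor
  rw [Finset.sum_eq_single 0]
  · simp
  · intro k _ hk
    have : NeZero k := ⟨hk⟩
    simp [hk]
  · simp

/-- Partial gradient of `f` in `x`. -/
noncomputable def gradX {n : ℕ} (f : ℝ × Sp n × Sp n → ℝ) (p : ℝ × Sp n × Sp n) : Sp n :=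
  WithLp.toLp 2 fun i => fderiv ℝ f p (0, EuclideanSpace.single i 1, 0)

/-- Partial gradient of `f` in `ξ`. -/
noncomputable def gradXi {n : ℕ} (f : ℝ × Sp n × Sp n → ℝ) (p : ℝ × Sp n × Sp n) : Sp n :=
  WithLp.toLp 2 fun i => fderiv ℝ f p (0, 0, EuclideanSpace.single i 1)

theorem sum_smul_single {n : ℕ} (s : Sp n) : ∑ i, s i • EuclideanSpace.single i (1 : ℝ) = s := by
  have := (EuclideanSpace.basisFun (Fin n) ℝ).sum_repr s
  simpa using this

theorem fderiv_x_eq {n : ℕ} (f : ℝ × Sp n × Sp n → ℝ) (p : ℝ × Sp n × Sp n) (s : Sp n) :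
    fderiv ℝ f p (0, s, 0) = ∑ i, gradX f p i * s i := by
  have h := map_sum ((fderiv ℝ f p).comp ((ContinuousLinearMap.inr ℝ ℝ (Sp n × Sp n)).comp
    (ContinuousLinearMap.inl ℝ (Sp n) (Sp n))))
    (fun i => s i • EuclideanSpace.single i (1 : ℝ)) Finset.univ
  rw [sum_smul_single] at h
  simpa [gradX, mul_comm] using h

theorem fderiv_xi_eq {n : ℕ} (f : ℝ × Sp n × Sp n → ℝ) (p : ℝ × Sp n × Sp n) (s : Sp n) :
    fderiv ℝ f p (0, 0, s) = ∑ i, gradXi f p i * s i := by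
  have h := map_sum ((fderiv ℝ f p).comp ((ContinuousLinearMap.inr ℝ ℝ (Sp n × Sp n)).comp
    (ContinuousLinearMap.inr ℝ (Sp n) (Sp n))))
    (fun i => s i • EuclideanSpace.single i (1 : ℝ)) Finset.univ
  rw [sum_smul_single] at h
  simpa [gradXi, mul_comm] using h

/-- Since σ vanishes at τ = 0, products of two or more of its components have zero derivative there.
Only k = 0 and k = 1 contribute, and N ≥ 1 ensures that the latter is present. -/
theorem hasDerivAt_symbolTaylor_line {n : ℕ} {f : ℝ × Sp n × Sp n → ℝ} (hf : ContDiff ℝ ∞ f)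
    {N : ℕ} (hN : 1 ≤ N) (t : ℝ) (y s η : Sp n) {σ : ℝ → Fin n → ℂ} {σ' : Fin n → ℂ}
    (hσ0 : ∀ j, σ 0 j = 0) (hσ : ∀ j, HasDerivAt (fun τ => σ τ j) (σ' j) 0) :
    HasDerivAt (fun τ : ℝ => symbolTaylor N f t (y + τ • s) η (σ τ))
      (∑ i, (gradX f (t, y, η) i * s i : ℂ) + ∑ j, gradXi f (t, y, η) j * σ' j) 0 := by
  simp only [symbolTaylor_eq hf]
  have hline : HasDerivAt (fun τ : ℝ => ((t, y + τ • s, η) : ℝ × Sp n × Sp n)) (0, s, 0) 0 := by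
    have h1 : HasDerivAt (fun τ : ℝ => y + τ • s) s 0 := by
      simpa using ((hasDerivAt_id (0 : ℝ)).smul_const s).const_add y
    exact (hasDerivAt_const _ _).prodMk (h1.prodMk (hasDerivAt_const _ _))
  have hcomp : ∀ g : ℝ × Sp n × Sp n → ℝ, ContDiff ℝ ∞ g →
      HasDerivAt (fun τ : ℝ => ((g (t, y + τ • s, η) : ℝ) : ℂ))
        ((fderiv ℝ g (t, y, η) (0, s, 0) : ℝ) : ℂ) 0 := by
    intro g hg
    have h1 : HasFDerivAt g (fderiv ℝ g (t, y, η)) (t, y + (0 : ℝ) • s, η) := by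
      simpa using (hg.differentiable (by simp) (t, y, η)).hasFDerivAt
    exact (h1.comp_hasDerivAt 0 hline).ofReal_comp
  have hprod : ∀ k (j : Fin k → Fin n), HasDerivAt (fun τ : ℝ => ∏ i, σ τ (j i))
      (∑ i, (∏ l ∈ Finset.univ.erase i, σ 0 (j l)) • σ' (j i)) 0 := fun k j =>
    HasDerivAt.fun_finsetProd fun i _ => hσ (j i)
  have hterm : ∀ k (j : Fin k → Fin n), HasDerivAt
      (fun τ : ℝ => ((symbCoef f j (t, y + τ • s, η) : ℝ) : ℂ) * ∏ i, σ τ (j i))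
      (((fderiv ℝ (symbCoef f j) (t, y, η) (0, s, 0) : ℝ) : ℂ) * ∏ i, σ 0 (j i) +
        ((symbCoef f j (t, y, η) : ℝ) : ℂ) *
          ∑ i, (∏ l ∈ Finset.univ.erase i, σ 0 (j l)) • σ' (j i)) 0 := by
    intro k j
    have := (hcomp _ (contDiff_symbCoef hf j)).fun_mul (hprod k j)
    simpa using this
  have h := HasDerivAt.fun_sum (u := Finset.range (N + 1)) (x := (0 : ℝ))
    (A := fun k (τ : ℝ) => ((k ! : ℕ) : ℂ)⁻¹ * ∑ j : Fin k → Fin n,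
      ((symbCoef f j (t, y + τ • s, η) : ℝ) : ℂ) * ∏ i, σ τ (j i))
    fun k _ => (HasDerivAt.fun_sum fun j _ => hterm k j).const_mul _
  refine h.congr_deriv ?_
  obtain ⟨N, rfl⟩ := Nat.exists_eq_add_of_le' hN
  rw [Finset.sum_range_succ', Finset.sum_range_succ', Finset.sum_eq_zero, zero_add, add_comm]
  · congr 1
    · have h0 : symbCoef f (default : Fin 0 → Fin n) = f := by
        funext p; simp [symbCoef]
      have hx := fderiv_x_eq f (t, y, η) s
      simp only [Nat.factorial_zero, Nat.cast_one, inv_one, one_mul, Finset.univ_unique,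
        Finset.sum_singleton, Finset.univ_eq_empty, Finset.prod_empty, mul_one, Finset.sum_empty,
        mul_zero, add_zero]
      rw [h0, hx]
      push_cast
      rfl
    · simp only [zero_add, Nat.factorial_one, Nat.cast_one, inv_one, one_mul]
      rw [← (Equiv.funUnique (Fin 1) (Fin n)).symm.sum_comp]
      refine Finset.sum_congr rfl fun j _ => ?_
      simp [hσ0, symbCoef, gradXi]
  · intro k _
    refine mul_eq_zero_of_right _ (Finset.sum_eq_zero fun j _ => ?_)
    have h1 : ∏ i, σ 0 (j i) = 0 := by simp [hσ0]
    have h2 : ∀ i, ∏ l ∈ Finset.univ.erase i, σ 0 (j l) = 0 := by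
      intro i
      obtain ⟨l, hl⟩ := exists_ne i
      exact Finset.prod_eq_zero (Finset.mem_erase.mpr ⟨hl, Finset.mem_univ l⟩) (hσ0 _)
    simp [h1, h2]

/-! ### The transport equations -/

/-- The parameters `(t, y, η, w, v)`: a point, the coefficients of a phase and a velocity. -/
abbrev Par (n K : ℕ) := ℝ × Sp n × Sp n × Coef n K × Sp n

/-- The function `⟨v, ∂P(s)⟩ - i f(t, y + s, η + ∂P(s))`, where `P = ∑ w_α s^α / α!`. -/
noncomputable def symbG {n : ℕ} (f : ℝ × Sp n × Sp n → ℝ) (K : ℕ) (q : Par n K × Sp n) : ℂ :=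
  ∑ j, ((q.1.2.2.2.2 j : ℝ) : ℂ) * gradPoly K (ext q.1.2.2.2.1) q.2 j -
    Complex.I * symbolTaylor K f q.1.1 (q.1.2.1 + q.2) q.1.2.2.1
      (gradPoly K (ext q.1.2.2.2.1) q.2)

theorem contDiff_coe_apply {n : ℕ} {P : Type*} [NormedAddCommGroup P] [NormedSpace ℝ P]
    {s : P → Sp n} (hs : ContDiff ℝ ∞ s) (j : Fin n) : ContDiff ℝ ∞ fun p => ((s p j : ℝ) : ℂ) :=
  Complex.ofRealCLM.contDiff.comp ((EuclideanSpace.proj (𝕜 := ℝ) j).contDiff.comp hs)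

theorem contDiff_symbG {n K : ℕ} {f : ℝ × Sp n × Sp n → ℝ} (hf : ContDiff ℝ ∞ f) :
    ContDiff ℝ ∞ (symbG f K) := by
  unfold symbG
  refine ContDiff.sub (ContDiff.sum fun j _ => ContDiff.mul ?_ ?_) (contDiff_const.mul ?_)
  · exact contDiff_coe_apply (by fun_prop) j
  · exact contDiff_gradPoly (by fun_prop) (by fun_prop) j
  · exact contDiff_symbolTaylor hf K (by fun_prop) (by fun_prop) (by fun_prop)
      fun j => contDiff_gradPoly (by fun_prop) (by fun_prop) j

/-- The multi-index with entries `#{l | j l = i}`. -/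
def typ {n k : ℕ} (j : Fin k → Fin n) : Fin n → ℕ := ∑ l, Pi.single (j l) 1

theorem sum_typ {n k : ℕ} (j : Fin k → Fin n) : ∑ i, typ j i = k := by
  simp only [typ, Finset.sum_apply]
  rw [Finset.sum_comm]
  simp

theorem mon_typ {n k : ℕ} (j : Fin k → Fin n) (s : Sp n) :
    mon (typ j) s = ∏ l, ((s (j l) : ℝ) : ℂ) := by
  simp only [mon, typ, Finset.sum_apply, ← Finset.prod_pow_eq_pow_sum]
  rw [Finset.prod_comm]
  refine Finset.prod_congr rfl fun l _ => ?_
  rw [Finset.prod_eq_single (j l)]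
  · simp
  · intro i _ hi
    simp [hi]
  · simp

/-- The coefficient of `s^α / α!` in the Taylor expansion of `symbG f K (p, s)` at `s = 0`. -/
noncomputable def coefG {n K : ℕ} (f : ℝ × Sp n × Sp n → ℝ) (α : Fin n → ℕ) (p : Par n K) : ℂ :=
  ((mfact α : ℂ) * (((∑ i, α i)! : ℝ)⁻¹ : ℝ)) *
    ∑ j : Fin (∑ i, α i) → Fin n with typ j = α,
      iteratedFDeriv ℝ (∑ i, α i) (symbG f K) (p, 0) fun i => (0, EuclideanSpace.single (j i) 1)

theorem contDiff_coefG {n K : ℕ} {f : ℝ × Sp n × Sp n → ℝ} (hf : ContDiff ℝ ∞ f)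
    (α : Fin n → ℕ) : ContDiff ℝ ∞ (coefG (K := K) f α) := by
  unfold coefG
  refine contDiff_const.mul (ContDiff.sum fun j _ => ?_)
  exact contDiff_iteratedFDeriv_apply (contDiff_symbG hf) _ (by fun_prop) _

theorem iteratedFDeriv_diag_eq_sum {n k : ℕ} {P F : Type*} [NormedAddCommGroup P]
    [NormedSpace ℝ P] [NormedAddCommGroup F] [NormedSpace ℝ F] (g : P × Sp n → F) (q : P × Sp n)
    (s : Sp n) :
    iteratedFDeriv ℝ k g q (fun _ => (0, s)) = ∑ j : Fin k → Fin n, (∏ l, s (j l)) •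
      iteratedFDeriv ℝ k g q fun i => (0, EuclideanSpace.single (j i) 1) := by
  have h : ((0, s) : P × Sp n) = ∑ i, s i • ((0, EuclideanSpace.single i 1) : P × Sp n) := by
    conv_lhs => rw [← sum_smul_single s]
    refine (map_sum (LinearMap.inr ℝ P (Sp n)) (fun i => s i • EuclideanSpace.single i (1 : ℝ))
      Finset.univ).trans (Finset.sum_congr rfl fun i _ => ?_)
    simp
  rw [h, ContinuousMultilinearMap.map_sum]
  exact Finset.sum_congr rfl fun j _ => ContinuousMultilinearMap.map_smul_univ _ _ _

/-- The words j in the multilinear expansion are grouped by their multi-index; the factor α!/|α|! in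
`coefG` turns the weights 1/α! of `poly` into the weight 1/k! of Taylor's formula. -/
theorem poly_coefG {n K : ℕ} (f : ℝ × Sp n × Sp n → ℝ) (p : Par n K) (s : Sp n) :
    poly K (fun α => coefG f α p) s = ∑ k ∈ Finset.Icc 2 K, (k ! : ℝ)⁻¹ •
      iteratedFDeriv ℝ k (symbG f K) (p, 0) fun _ => (0, s) := by
  rw [poly, sum_idx]
  refine Finset.sum_congr rfl fun k _ => ?_
  rw [iteratedFDeriv_diag_eq_sum, ← Finset.sum_fiberwise_of_maps_to (s := Finset.univ)
    (t := Finset.piAntidiag Finset.univ k) (g := fun j => typ j)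
    (fun j _ => by simp [Finset.mem_piAntidiag, sum_typ]), Finset.smul_sum]
  refine Finset.sum_congr rfl fun α hα => ?_
  obtain ⟨rfl, -⟩ := Finset.mem_piAntidiag.mp hα
  have h1 : ∀ j ∈ Finset.univ.filter (fun j : Fin (Finset.univ.sum α) → Fin n => typ j = α),
      (∏ l, s (j l)) • iteratedFDeriv ℝ (Finset.univ.sum α) (symbG f K) (p, 0)
        (fun i => (0, EuclideanSpace.single (j i) 1)) = mon α s *
      iteratedFDeriv ℝ (Finset.univ.sum α) (symbG f K) (p, 0)
        (fun i => (0, EuclideanSpace.single (j i) 1)) := by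
    intro j hj
    have hm : mon α s = ∏ l, ((s (j l) : ℝ) : ℂ) := by
      rw [← mon_typ, (Finset.mem_filter.mp hj).2]
    rw [hm, Complex.real_smul, Complex.ofReal_prod]
  rw [Finset.sum_congr rfl h1, ← Finset.mul_sum, coefG, Complex.real_smul]
  have := mfact_ne_zero α
  field_simp

theorem iteratedFDeriv_one_symbG {n K : ℕ} (hK : 2 ≤ K) {f : ℝ × Sp n × Sp n → ℝ}
    (hf : ContDiff ℝ ∞ f) (t : ℝ) (y η : Sp n) (w : Coef n K) (v s : Sp n) :
    (iteratedFDeriv ℝ 1 (symbG f K) ((t, y, η, w, v), 0) fun _ => (0, s)) =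
      ∑ j, (v j : ℂ) * (∑ i, hess (ext w) i j * s i) -
        Complex.I * (∑ i, (gradX f (t, y, η) i * s i : ℂ) +
          ∑ j, (gradXi f (t, y, η) j : ℂ) * (∑ i, hess (ext w) i j * s i)) := by
  have h1 := iteratedDeriv_comp_line (contDiff_symbG (K := K) hf) ((t, y, η, w, v), 0) (0, s) 1 0
  rw [zero_smul, add_zero] at h1
  rw [← h1, iteratedDeriv_one]
  refine HasDerivAt.deriv ?_
  have h2 := hasDerivAt_symbolTaylor_line hf (N := K) (by omega) t y s η
    (σ := fun τ => gradPoly K (ext w) (τ • s)) (fun j => by simp [gradPoly_zero])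
    (fun j => hasDerivAt_gradPoly_line hK (ext w) s j)
  have h3 := (HasDerivAt.fun_sum (u := Finset.univ) fun j _ =>
    (hasDerivAt_gradPoly_line hK (ext w) s j).const_mul (v j : ℂ)).fun_sub
      (h2.const_mul Complex.I)
  simpa [symbG] using h3

theorem symbG_zero {n K : ℕ} (f : ℝ × Sp n × Sp n → ℝ) (t : ℝ) (y η : Sp n) (w : Coef n K)
    (v : Sp n) : symbG f K ((t, y, η, w, v), 0) = -(Complex.I * f (t, y, η)) := by
  have : gradPoly K (ext w) 0 = fun _ => 0 := funext fun j => gradPoly_zero _ j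
  simp [symbG, this, symbolTaylor_zero]

/-- With zero velocity, `symbG` is a sum of terms each containing a ξ-derivative of f at (t, y + s,
η); these factors are flat at s = 0, and flatness survives multiplication by smooth functions. -/
theorem coefG_eq_zero_of_flat {n K : ℕ} {f : ℝ × Sp n × Sp n → ℝ} (hf : ContDiff ℝ ∞ f)
    (α : Fin n → ℕ) {t : ℝ} {y η : Sp n} (w : Coef n K) (hflat : Flat f (t, y, η)) :
    coefG f α (t, y, η, w, 0) = 0 := by
  have hσ : ∀ j, ContDiff ℝ ∞ fun s : Sp n => gradPoly K (ext w) s j := fun j =>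
    contDiff_gradPoly (w := fun _ => w) (s := fun s => s) contDiff_const contDiff_id j
  have hc : ∀ k (j : Fin k → Fin n), ContDiff ℝ ∞ fun s : Sp n => symbCoef f j (t, y + s, η) :=
    fun k j => (contDiff_symbCoef hf j).comp (by fun_prop)
  have hfl : Flat (fun s : Sp n => symbG f K ((t, y, η, w, 0), s)) 0 := by
    have heq : (fun s : Sp n => symbG f K ((t, y, η, w, 0), s)) = fun s =>
        ∑ k ∈ Finset.range (K + 1), ∑ j : Fin k → Fin n,
          Complex.ofRealCLM (symbCoef f j (t, y + s, η)) *
            (-Complex.I * ((k ! : ℕ) : ℂ)⁻¹ * ∏ i, gradPoly K (ext w) s (j i)) := by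
      funext s
      simp only [symbG, symbolTaylor_eq hf, Finset.mul_sum]
      simp only [PiLp.zero_apply, Complex.ofReal_zero, zero_mul, Finset.sum_const_zero, zero_sub,
        ← Finset.sum_neg_distrib]
      refine Finset.sum_congr rfl fun k _ => Finset.sum_congr rfl fun j _ => ?_
      simp only [Complex.ofRealCLM_apply]
      ring
    rw [heq]
    have hl : ∀ k (j : Fin k → Fin n),
        ContDiff ℝ ∞ fun s : Sp n => Complex.ofRealCLM (symbCoef f j (t, y + s, η)) :=
      fun k j => Complex.ofRealCLM.contDiff.comp (hc k j)
    have hr : ∀ k (j : Fin k → Fin n), ContDiff ℝ ∞ fun s : Sp n =>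
        (-Complex.I * ((k ! : ℕ) : ℂ)⁻¹ * ∏ i, gradPoly K (ext w) s (j i)) :=
      fun k j => contDiff_const.mul (contDiff_prod fun i _ => hσ (j i))
    refine Flat.sum (fun k _ => ContDiff.sum fun j _ => (hl k j).mul (hr k j)) fun k _ =>
      Flat.sum (fun j _ => (hl k j).mul (hr k j)) fun j _ =>
        Flat.mul (hl k j) (hr k j) (Flat.clm_comp (hc k j) ?_ _)
    have := (hflat.iteratedFDeriv_apply hf k fun i =>
      (0, 0, EuclideanSpace.single (j i) 1)).comp_affine (contDiff_symbCoef hf j)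
        ((ContinuousLinearMap.inr ℝ ℝ (Sp n × Sp n)).comp
          (ContinuousLinearMap.inl ℝ (Sp n) (Sp n)))
    simpa [symbCoef] using this
  rw [coefG]
  refine mul_eq_zero_of_right _ (Finset.sum_eq_zero fun j _ => ?_)
  have := iteratedFDeriv_comp_affine (contDiff_symbG (K := K) hf)
    (ContinuousLinearMap.inr ℝ (Par n K) (Sp n)) ((t, y, η, w, 0), 0) (∑ i, α i) 0
  simp only [ContinuousLinearMap.inr_apply, Prod.mk_add_mk, add_zero, zero_add] at this
  rw [hfl] at this
  have h2 := congrArg (fun u => u fun i => EuclideanSpace.single (j i) 1) this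
  simpa using h2.symm

/-- The operator with matrix `a`. -/
noncomputable def opOf {n : ℕ} (a : Fin n → Fin n → ℝ) : Sp n →L[ℝ] Sp n :=
  ∑ i, ∑ j, a i j • (EuclideanSpace.proj (𝕜 := ℝ) j : Sp n →L[ℝ] ℝ).smulRight
    (EuclideanSpace.single i (1 : ℝ))

theorem opOf_apply {n : ℕ} (a : Fin n → Fin n → ℝ) (v : Sp n) (i : Fin n) :
    opOf a v i = ∑ j, a i j * v j := by
  simp only [opOf, _root_.sum_apply, _root_.smul_apply, ContinuousLinearMap.smulRight_apply,
    WithLp.ofLp_sum, Finset.sum_apply, PiLp.smul_apply, PiLp.proj_apply, smul_eq_mul]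
  rw [Finset.sum_eq_single i]
  · simp
  · intro l _ hl
    simp [hl.symm]
  · simp

/-- The real part of the Hessian of the phase. -/
noncomputable def reOp {n K : ℕ} (w : Coef n K) : Sp n →L[ℝ] Sp n :=
  opOf fun i j => (hess (ext w) i j).re

/-- The imaginary part of the Hessian of the phase. -/
noncomputable def imOp {n K : ℕ} (w : Coef n K) : Sp n →L[ℝ] Sp n :=
  opOf fun i j => (hess (ext w) i j).im

theorem contDiff_reOp {n K : ℕ} : ContDiff ℝ ∞ (reOp (n := n) (K := K)) := by
  unfold reOp opOf
  refine ContDiff.sum fun i _ => ContDiff.sum fun j _ => ContDiff.fun_smul ?_ contDiff_const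
  exact Complex.reCLM.contDiff.comp (contDiff_ext _)

theorem contDiff_imOp {n K : ℕ} : ContDiff ℝ ∞ (imOp (n := n) (K := K)) := by
  unfold imOp opOf
  refine ContDiff.sum fun i _ => ContDiff.sum fun j _ => ContDiff.fun_smul ?_ contDiff_const
  exact Complex.imCLM.contDiff.comp (contDiff_ext _)

theorem contDiff_gradX {n : ℕ} {f : ℝ × Sp n × Sp n → ℝ} (hf : ContDiff ℝ ∞ f) :
    ContDiff ℝ ∞ (gradX f) := by
  have h : ContDiff ℝ ∞ (fderiv ℝ f) := hf.fderiv_right (mod_cast le_top)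
  rw [contDiff_piLp]
  exact fun i => h.clm_apply contDiff_const

theorem contDiff_gradXi {n : ℕ} {f : ℝ × Sp n × Sp n → ℝ} (hf : ContDiff ℝ ∞ f) :
    ContDiff ℝ ∞ (gradXi f) := by
  have h : ContDiff ℝ ∞ (fderiv ℝ f) := hf.fderiv_right (mod_cast le_top)
  rw [contDiff_piLp]
  exact fun i => h.clm_apply contDiff_const

/-- The states `(y, η, w)`: base point, covector and coefficients of a phase. -/
abbrev St (n K : ℕ) := Sp n × Sp n × Coef n K

/-- The velocity of the base point. -/
noncomputable def velY {n K : ℕ} (f : ℝ × Sp n × Sp n → ℝ) (p : ℝ × St n K) : Sp n :=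
  Ring.inverse (imOp p.2.2.2) (gradX f (p.1, p.2.1, p.2.2.1) +
    reOp p.2.2.2 (gradXi f (p.1, p.2.1, p.2.2.1)))

/-- The vector field whose integral curves give approximate solutions of the eikonal equation. -/
noncomputable def field {n K : ℕ} (f : ℝ × Sp n × Sp n → ℝ) (p : ℝ × St n K) : St n K :=
  (velY f p, reOp p.2.2.2 (velY f p) + imOp p.2.2.2 (gradXi f (p.1, p.2.1, p.2.2.1)),
    fun α => coefG f α (p.1, p.2.1, p.2.2.1, p.2.2.2, velY f p))

/-- `Ring.inverse` takes the value 0 at non-units and is smooth at units, hence the restriction to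
invertible Im w₂. -/
theorem contDiffAt_field {n K : ℕ} {f : ℝ × Sp n × Sp n → ℝ} (hf : ContDiff ℝ ∞ f)
    {p : ℝ × St n K} (hp : IsUnit (imOp p.2.2.2)) : ContDiffAt ℝ ∞ (field f) p := by
  have hpt : ContDiff ℝ ∞ fun p : ℝ × St n K => (p.1, p.2.1, p.2.2.1) := by fun_prop
  have hw : ContDiff ℝ ∞ fun p : ℝ × St n K => p.2.2.2 := by fun_prop
  have hre := contDiff_reOp.comp hw
  have him := contDiff_imOp.comp hw
  have hY : ContDiffAt ℝ ∞ (velY (K := K) f) p := by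
    unfold velY
    obtain ⟨u, hu⟩ := hp
    have hinv : ContDiffAt ℝ ∞ (fun p : ℝ × St n K => Ring.inverse (imOp p.2.2.2)) p := by
      have h1 : ContDiffAt ℝ ∞ (Ring.inverse (M₀ := Sp n →L[ℝ] Sp n)) (imOp p.2.2.2) := by
        rw [← hu]
        exact contDiffAt_ringInverse ℝ u
      exact ContDiffAt.comp (f := fun p : ℝ × St n K => imOp p.2.2.2) p h1 him.contDiffAt
    exact hinv.clm_apply (((contDiff_gradX hf).comp hpt).add
      (hre.clm_apply ((contDiff_gradXi hf).comp hpt))).contDiffAt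
  refine hY.prodMk (ContDiffAt.prodMk ?_ ?_)
  · exact (hre.contDiffAt.clm_apply hY).add
      (him.clm_apply ((contDiff_gradXi hf).comp hpt)).contDiffAt
  · rw [contDiffAt_pi]
    intro α
    have h1 : ContDiffAt ℝ ∞ (fun p : ℝ × St n K =>
        (p.1, p.2.1, p.2.2.1, p.2.2.2, velY f p)) p := by
      refine ContDiffAt.prodMk (by fun_prop) (ContDiffAt.prodMk (by fun_prop)
        (ContDiffAt.prodMk (by fun_prop) (ContDiffAt.prodMk (by fun_prop) hY)))
    exact (contDiff_coefG hf α.1).contDiffAt.comp (f := fun p : ℝ × St n K =>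
        (p.1, p.2.1, p.2.2.1, p.2.2.2, velY f p)) p h1

theorem gradX_eq_zero {n : ℕ} {f : ℝ × Sp n × Sp n → ℝ} {p : ℝ × Sp n × Sp n}
    (h : ∀ s s', fderiv ℝ f p (0, s, s') = 0) : gradX f p = 0 := by
  ext i; simp [gradX, h]

theorem gradXi_eq_zero {n : ℕ} {f : ℝ × Sp n × Sp n → ℝ} {p : ℝ × Sp n × Sp n}
    (h : ∀ s s', fderiv ℝ f p (0, s, s') = 0) : gradXi f p = 0 := by
  ext i; simp [gradXi, h]

theorem velY_eq_zero {n K : ℕ} {f : ℝ × Sp n × Sp n → ℝ} {p : ℝ × St n K}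
    (h : ∀ s s', fderiv ℝ f (p.1, p.2.1, p.2.2.1) (0, s, s') = 0) : velY f p = 0 := by
  simp [velY, gradX_eq_zero h, gradXi_eq_zero h]

/-- At a critical point of f in (x, ξ) the base point and covector stand still. This is where `field
f` agrees with the comparison field that moves the coefficients only. -/
theorem field_eq_of_fderiv_eq_zero {n K : ℕ} {f : ℝ × Sp n × Sp n → ℝ} {p : ℝ × St n K}
    (h : ∀ s s', fderiv ℝ f (p.1, p.2.1, p.2.2.1) (0, s, s') = 0) :
    field f p = (0, 0, (field f p).2.2) := by
  simp [field, velY_eq_zero h, gradXi_eq_zero h]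

/-- The points of Γ, with any fixed coefficients, are thus equilibria when f is flat there. -/
theorem field_eq_zero_of_flat {n K : ℕ} {f : ℝ × Sp n × Sp n → ℝ} (hf : ContDiff ℝ ∞ f)
    {p : ℝ × St n K} (hflat : Flat f (p.1, p.2.1, p.2.2.1)) : field f p = 0 := by
  have h : ∀ s s', fderiv ℝ f (p.1, p.2.1, p.2.2.1) (0, s, s') = 0 := by
    intro s s'
    rw [hflat.fderiv.apply_eq_zero]
    rfl
  rw [field_eq_of_fderiv_eq_zero h]
  refine Prod.ext rfl (Prod.ext rfl ?_)
  funext α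
  simp only [field, velY_eq_zero h, Prod.snd_zero, Pi.zero_apply]
  exact coefG_eq_zero_of_flat hf α _ hflat

theorem imOp_velY {n K : ℕ} (f : ℝ × Sp n × Sp n → ℝ) {p : ℝ × St n K}
    (hp : IsUnit (imOp p.2.2.2)) : imOp p.2.2.2 (velY f p) =
      gradX f (p.1, p.2.1, p.2.2.1) + reOp p.2.2.2 (gradXi f (p.1, p.2.1, p.2.2.1)) := by
  have := Ring.mul_inverse_cancel _ hp
  rw [velY, ← _root_.mul_apply_eq_comp, this, _root_.one_apply_eq_self]

/-- The first order terms in the eikonal equation cancel. -/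
theorem iteratedFDeriv_one_symbG_field {n K : ℕ} (hK : 2 ≤ K) {f : ℝ × Sp n × Sp n → ℝ}
    (hf : ContDiff ℝ ∞ f) (t : ℝ) (y η : Sp n) (w : Coef n K) (hp : IsUnit (imOp w)) (s : Sp n) :
    (iteratedFDeriv ℝ 1 (symbG f K) ((t, y, η, w, (field f (t, y, η, w)).1), 0) fun _ => (0, s)) =
      ((inner ℝ s (field f (t, y, η, w)).2.1 : ℝ) : ℂ) := by
  rw [iteratedFDeriv_one_symbG hK hf]
  have h1 := imOp_velY f (p := (t, y, η, w)) hp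
  set Y := velY f (t, y, η, w) with hY
  have hfst : (field f (t, y, η, w)).1 = Y := rfl
  have hsnd : (field f (t, y, η, w)).2.1 = reOp w Y + imOp w (gradXi f (t, y, η)) := rfl
  rw [hfst, hsnd]
  dsimp only at h1
  -- The imaginary part vanishes by the equation that defines the velocity Y; the real part is the
  -- prescribed derivative of the covector.
  have h2 : ∀ i, ∑ j, (Y j : ℂ) * hess (ext w) i j - Complex.I * (gradX f (t, y, η) i +
      ∑ j, (gradXi f (t, y, η) j : ℂ) * hess (ext w) i j) =
      ((reOp w Y + imOp w (gradXi f (t, y, η))) i : ℝ) := by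
    intro i
    have h3 := congrArg (fun u : Sp n => u i) h1
    simp only [PiLp.add_apply, reOp, imOp, opOf_apply] at h3 ⊢
    apply Complex.ext
    · simp [Complex.re_sum, Complex.im_sum, mul_comm]
    · simp [Complex.re_sum, Complex.im_sum, mul_comm] at h3 ⊢
      linarith
  have h3 : ((inner ℝ s (reOp w Y + imOp w (gradXi f (t, y, η))) : ℝ) : ℂ) =
      ∑ i, (s i : ℂ) * ((reOp w Y + imOp w (gradXi f (t, y, η))) i : ℝ) := by
    rw [PiLp.inner_apply]
    push_cast
    refine Finset.sum_congr rfl fun i _ => ?_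
    simp [mul_comm]
  rw [h3]
  simp only [← h2]
  simp only [mul_sub, mul_add, Finset.mul_sum, Finset.sum_sub_distrib, Finset.sum_add_distrib]
  congr 1
  · rw [Finset.sum_comm]
    exact Finset.sum_congr rfl fun i _ => Finset.sum_congr rfl fun j _ => by ring
  · congr 1
    · exact Finset.sum_congr rfl fun i _ => by ring
    · rw [Finset.sum_comm]
      exact Finset.sum_congr rfl fun i _ => Finset.sum_congr rfl fun j _ => by ring

/-! ### Uniform orders of vanishing -/

section
variable {P G F : Type*} [NormedAddCommGroup G] [NormedAddCommGroup F]

/-- `g (p, s) = O(|s| ^ m)` for `|s| ≤ 1`, uniformly for `p ∈ C`. -/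
def VanishOrder (C : Set P) (m : ℕ) (g : P × G → F) : Prop :=
  ∃ c : ℝ, ∀ p ∈ C, ∀ s : G, ‖s‖ ≤ 1 → ‖g (p, s)‖ ≤ c * ‖s‖ ^ m

variable {C : Set P}

theorem VanishOrder.add {m : ℕ} {g k : P × G → F} (hg : VanishOrder C m g)
    (hk : VanishOrder C m k) : VanishOrder C m fun q => g q + k q := by
  obtain ⟨c, hc⟩ := hg
  obtain ⟨d, hd⟩ := hk
  refine ⟨c + d, fun p hp s hs => (norm_add_le _ _).trans ?_⟩
  rw [add_mul]
  exact add_le_add (hc p hp s hs) (hd p hp s hs)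

theorem VanishOrder.neg {m : ℕ} {g : P × G → F} (hg : VanishOrder C m g) :
    VanishOrder C m fun q => -g q := by
  obtain ⟨c, hc⟩ := hg
  exact ⟨c, fun p hp s hs => by rw [norm_neg]; exact hc p hp s hs⟩

theorem VanishOrder.sub {m : ℕ} {g k : P × G → F} (hg : VanishOrder C m g)
    (hk : VanishOrder C m k) : VanishOrder C m fun q => g q - k q := by
  simpa [sub_eq_add_neg] using hg.add hk.neg

theorem VanishOrder.sum {ι : Type*} {u : Finset ι} {m : ℕ} {g : ι → P × G → F}
    (hg : ∀ i ∈ u, VanishOrder C m (g i)) : VanishOrder C m fun q => ∑ i ∈ u, g i q := by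
  classical
  induction u using Finset.induction_on with
  | empty => exact ⟨0, fun p _ s _ => by simp⟩
  | insert a u ha ih =>
    simp only [Finset.sum_insert ha]
    exact (hg a (Finset.mem_insert_self _ _)).add
      (ih fun i hi => hg i (Finset.mem_insert_of_mem hi))

theorem VanishOrder.mul {m m' : ℕ} {g k : P × G → ℂ} (hg : VanishOrder C m g)
    (hk : VanishOrder C m' k) : VanishOrder C (m + m') fun q => g q * k q := by
  obtain ⟨c, hc⟩ := hg
  obtain ⟨d, hd⟩ := hk
  refine ⟨c * d, fun p hp s hs => ?_⟩
  rw [norm_mul, pow_add, mul_mul_mul_comm]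
  exact mul_le_mul (hc p hp s hs) (hd p hp s hs) (norm_nonneg _)
    ((norm_nonneg _).trans (hc p hp s hs))

theorem VanishOrder.prod {k : ℕ} {g : Fin k → P × G → ℂ}
    (hg : ∀ i, VanishOrder C 1 (g i)) : VanishOrder C k fun q => ∏ i, g i q := by
  induction k with
  | zero => exact ⟨1, fun p _ s _ => by simp⟩
  | succ k ih =>
    simp only [Fin.prod_univ_succ]
    have := (hg 0).mul (ih fun i => hg i.succ)
    rwa [add_comm] at this

theorem VanishOrder.mono {m m' : ℕ} (h : m' ≤ m) {g : P × G → F} (hg : VanishOrder C m g) :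
    VanishOrder C m' g := by
  obtain ⟨c, hc⟩ := hg
  refine ⟨max c 0, fun p hp s hs => (hc p hp s hs).trans ?_⟩
  exact mul_le_mul (le_max_left _ _) (pow_le_pow_of_le_one (norm_nonneg _) hs h)
    (by positivity) (le_max_right _ _)

theorem VanishOrder.of_continuous [TopologicalSpace P] [NormedSpace ℝ G] [FiniteDimensional ℝ G]
    {C : Set P} (hC : IsCompact C) {g : P × G → F} (hg : Continuous g) : VanishOrder C 0 g := by
  obtain ⟨c, hc⟩ := (hC.prod (isCompact_closedBall (0 : G) 1)).exists_bound_of_continuousOn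
    hg.continuousOn
  exact ⟨c, fun p hp s hs => by simpa using hc (p, s) ⟨hp, by simpa using hs⟩⟩

theorem VanishOrder.of_contDiff {P : Type*} [NormedAddCommGroup P] [NormedSpace ℝ P]
    [NormedSpace ℝ G] [NormedSpace ℝ F] [FiniteDimensional ℝ G] {C : Set P} (hC : IsCompact C)
    {g : P × G → F} (hg : ContDiff ℝ ∞ g) (h0 : ∀ p ∈ C, g (p, 0) = 0) : VanishOrder C 1 g := by
  obtain ⟨c, hc⟩ := exists_taylor_bound hg hC 0
  exact ⟨c, fun p hp s hs => by simpa [h0 p hp] using hc p hp s hs⟩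

end

/-- A term of degree k in the gradient of P is O(|s|^k), because that gradient vanishes at s = 0. -/
theorem vanishOrder_symbolTaylor_sub {n K : ℕ} {f : ℝ × Sp n × Sp n → ℝ} (hf : ContDiff ℝ ∞ f)
    {C : Set (Par n K)} (hC : IsCompact C) {M N : ℕ} (hMN : M ≤ N) :
    VanishOrder C (M + 1) fun q : Par n K × Sp n =>
      symbolTaylor N f q.1.1 (q.1.2.1 + q.2) q.1.2.2.1 (gradPoly K (ext q.1.2.2.2.1) q.2) -
      symbolTaylor M f q.1.1 (q.1.2.1 + q.2) q.1.2.2.1 (gradPoly K (ext q.1.2.2.2.1) q.2) := by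
  simp only [symbolTaylor_eq hf]
  have h : ∀ g : ℕ → ℂ, ∑ k ∈ Finset.range (N + 1), g k - ∑ k ∈ Finset.range (M + 1), g k =
      ∑ k ∈ Finset.Ico (M + 1) (N + 1), g k := fun g => by
    rw [Finset.sum_Ico_eq_sub _ (by omega)]
  simp only [h, Finset.mul_sum]
  refine VanishOrder.sum fun k hk => VanishOrder.sum fun j _ => ?_
  refine VanishOrder.mono (Finset.mem_Ico.mp hk).1 ?_
  have h1 : VanishOrder C k fun q : Par n K × Sp n =>
      ∏ i, gradPoly K (ext q.1.2.2.2.1) q.2 (j i) := VanishOrder.prod fun i =>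
    VanishOrder.of_contDiff hC (contDiff_gradPoly (by fun_prop) (by fun_prop) (j i))
      fun p _ => gradPoly_zero _ _
  have h2 : VanishOrder C 0 fun q : Par n K × Sp n => ((k ! : ℕ) : ℂ)⁻¹ *
      ((symbCoef f j (q.1.1, q.1.2.1 + q.2, q.1.2.2.1) : ℝ) : ℂ) := by
    refine VanishOrder.of_continuous hC (continuous_const.mul
      (Complex.continuous_ofReal.comp ((contDiff_symbCoef hf j).continuous.comp ?_)))
    fun_prop
  have h3 := h2.mul h1
  rw [zero_add] at h3
  simpa only [mul_assoc] using h3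

/-! ### The eikonal equation along integral curves -/

theorem symbolTaylor_congr {n N : ℕ} {f g : ℝ × Sp n × Sp n → ℝ} {U : Set (ℝ × Sp n × Sp n)}
    (hU : IsOpen U) (hfg : EqOn f g U) {t : ℝ} {x ξ : Sp n} (h : (t, x, ξ) ∈ U) (σ : Fin n → ℂ) :
    symbolTaylor N f t x ξ σ = symbolTaylor N g t x ξ σ := by
  have hev : (fun η => f (t, x, η)) =ᶠ[𝓝 ξ] fun η => g (t, x, η) := by
    have hc : ContinuousAt (fun η : Sp n => ((t, x, η) : ℝ × Sp n × Sp n)) ξ := by fun_prop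
    filter_upwards [hc.preimage_mem_nhds (hU.mem_nhds h)] with η hη using hfg hη
  unfold symbolTaylor
  refine Finset.sum_congr rfl fun k _ => ?_
  rw [(hev.iteratedFDeriv ℝ k).eq_of_nhds]

theorem partialX_phase {n K : ℕ} (w₀ : ℝ → ℂ) (x₀ ξ₀ : ℝ → Sp n) (w : (Fin n → ℕ) → ℝ → ℂ) (t : ℝ)
    (x : Sp n) (j : Fin n) : partialX (phase K w₀ x₀ ξ₀ w) t x j =
      ((ξ₀ t j : ℝ) : ℂ) + gradPoly K (fun α => w α t) (x - x₀ t) j := by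
  have hsub : HasFDerivAt (fun x : Sp n => x - x₀ t) (ContinuousLinearMap.id ℝ (Sp n)) x :=
    (hasFDerivAt_id x).sub_const _
  have h1 : HasFDerivAt (fun x : Sp n => ((inner ℝ (x - x₀ t) (ξ₀ t) : ℝ) : ℂ))
      (Complex.ofRealCLM.comp (innerSL ℝ (ξ₀ t))) x := by
    have h2 : HasFDerivAt (fun x : Sp n => innerSL ℝ (ξ₀ t) (x - x₀ t)) (innerSL ℝ (ξ₀ t)) x :=
      (innerSL ℝ (ξ₀ t)).hasFDerivAt.comp x hsub
    have h3 := Complex.ofRealCLM.hasFDerivAt.comp x h2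
    refine h3.congr_of_eventuallyEq (Eventually.of_forall fun x => ?_)
    simp [real_inner_comm]
  have h4 := (hasFDerivAt_poly (K := K) (fun α => w α t) (x - x₀ t)).comp x hsub
  have h5 := (h1.const_add (w₀ t)).fun_add h4
  have h6 : HasFDerivAt (phase K w₀ x₀ ξ₀ w t) _ x := h5.congr_of_eventuallyEq
    (Eventually.of_forall fun x => phase_eq w₀ x₀ ξ₀ w t x)
  rw [partialX, h6.fderiv]
  simp [_root_.sum_apply, EuclideanSpace.inner_single_right, apply_ite Complex.ofReal]

/-- For fixed x the variable s moves with velocity -Y, which produces the term in ⟨Y, ∂P(s)⟩. Up to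
the order of truncation, the last two terms are minus `symbG`, whose Taylor coefficients the field
is built to cancel. -/
theorem eikonalLHS_eq {n K N : ℕ} (f : ℝ × Sp n × Sp n → ℝ) {w₀ : ℝ → ℂ} {x₀ ξ₀ : ℝ → Sp n}
    {w : (Fin n → ℕ) → ℝ → ℂ} {t : ℝ} {w₀' : ℂ} {Y H : Sp n} {w' : (Fin n → ℕ) → ℂ}
    (hw₀ : HasDerivAt w₀ w₀' t) (hx₀ : HasDerivAt x₀ Y t) (hξ₀ : HasDerivAt ξ₀ H t)
    (hw : ∀ α, HasDerivAt (w α) (w' α) t) (s : Sp n) :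
    eikonalLHS N f ξ₀ (phase K w₀ x₀ ξ₀ w) t (x₀ t + s) =
      w₀' - ((inner ℝ Y (ξ₀ t) : ℝ) : ℂ) + ((inner ℝ s H : ℝ) : ℂ) + poly K w' s -
        ∑ j, ((Y j : ℝ) : ℂ) * gradPoly K (fun α => w α t) s j +
        Complex.I * symbolTaylor N f t (x₀ t + s) (ξ₀ t) (gradPoly K (fun α => w α t) s) := by
  have hs : x₀ t + s - x₀ t = s := by abel
  have hsub : HasDerivAt (fun τ => x₀ t + s - x₀ τ) (-Y) t := by
    simpa using hx₀.const_sub (x₀ t + s)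
  have h1 : HasDerivAt (fun τ => ((inner ℝ (x₀ t + s - x₀ τ) (ξ₀ τ) : ℝ) : ℂ))
      ((inner ℝ s H + inner ℝ (-Y) (ξ₀ t) : ℝ) : ℂ) t := by
    have := (hsub.inner ℝ hξ₀).ofReal_comp
    rwa [hs] at this
  have hmon : ∀ β, HasDerivAt (fun τ => mon β (x₀ t + s - x₀ τ))
      (-∑ j, (β j : ℂ) * mon (β - Pi.single j 1) s * Y j) t := by
    intro β
    have := (hasFDerivAt_mon β (x₀ t + s - x₀ t)).comp_hasDerivAt t hsub
    rw [hs] at this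
    simpa [Function.comp_def, _root_.sum_apply] using this
  have h2 : HasDerivAt (fun τ => poly K (fun α => w α τ) (x₀ t + s - x₀ τ))
      (poly K w' s - ∑ j, ((Y j : ℝ) : ℂ) * gradPoly K (fun α => w α t) s j) t := by
    have := HasDerivAt.fun_sum (u := idx n K) (x := t)
      (A := fun α τ => w α τ * mon α (x₀ t + s - x₀ τ) / mfact α)
      fun α _ => ((hw α).fun_mul (hmon α)).div_const (mfact α : ℂ)
    refine this.congr_deriv ?_
    simp only [poly, gradPoly, hs, Finset.mul_sum]
    rw [Finset.sum_comm, ← Finset.sum_sub_distrib]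
    refine Finset.sum_congr rfl fun α _ => ?_
    rw [add_div, mul_neg, neg_div, ← sub_eq_add_neg, Finset.mul_sum, Finset.sum_div]
    congr 1
    exact Finset.sum_congr rfl fun j _ => by ring
  have h3 : HasDerivAt (fun τ => phase K w₀ x₀ ξ₀ w τ (x₀ t + s)) _ t :=
    ((hw₀.fun_add h1).fun_add h2).congr_of_eventuallyEq
      (Eventually.of_forall fun τ => phase_eq w₀ x₀ ξ₀ w τ _)
  have h4 : (fun j => partialX (phase K w₀ x₀ ξ₀ w) t (x₀ t + s) j - ((ξ₀ t j : ℝ) : ℂ)) =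
      gradPoly K (fun α => w α t) s := by
    funext j
    rw [partialX_phase, hs]
    ring
  rw [eikonalLHS, h3.deriv, h4, inner_neg_left]
  push_cast
  ring

/-- Along an integral curve of `field f`, the eikonal equation holds to high order. -/
theorem exists_eikonal_bound {n M : ℕ} {f : ℝ × Sp n × Sp n → ℝ}
    (hf : ContDiff ℝ ∞ f) {s₁ s₂ : ℝ} {e : ℝ → St n (M + 2)}
    (he : ∀ t ∈ Icc s₁ s₂, HasDerivAt e (field f (t, e t)) t)
    (hunit : ∀ t ∈ Icc s₁ s₂, IsUnit (imOp (e t).2.2)) {w₀ : ℝ → ℂ}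
    (hw₀ : ∀ t ∈ Ioo s₁ s₂, HasDerivAt w₀ (((inner ℝ (field f (t, e t)).1 (e t).2.1 : ℝ) : ℂ) -
      Complex.I * f (t, (e t).1, (e t).2.1)) t) {N : ℕ} (hN : M ≤ N) :
    ∃ c : ℝ, ∀ t ∈ Ioo s₁ s₂, ∀ s : Sp n, ‖s‖ ≤ 1 →
      ‖eikonalLHS N f (fun t => (e t).2.1) (phase (M + 2) w₀ (fun t => (e t).1)
        (fun t => (e t).2.1) (fun α t => ext (e t).2.2 α)) t ((e t).1 + s)‖ ≤ c * ‖s‖ ^ M := by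
  set par : ℝ → Par n (M + 2) := fun t =>
    (t, (e t).1, (e t).2.1, (e t).2.2, (field f (t, e t)).1) with hpar
  have hec : ContinuousOn e (Icc s₁ s₂) := fun t ht => (he t ht).continuousAt.continuousWithinAt
  have hparc : ContinuousOn par (Icc s₁ s₂) := by
    have hY : ContinuousOn (fun t => field f (t, e t)) (Icc s₁ s₂) := by
      intro t ht
      have h1 := (contDiffAt_field hf (p := (t, e t)) (hunit t ht)).continuousAt
      exact (ContinuousAt.comp (f := fun t => (t, e t)) h1
        (continuousAt_id.prodMk (he t ht).continuousAt)).continuousWithinAt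
    exact continuousOn_id.prodMk (hec.fst.prodMk (hec.snd.fst.prodMk (hec.snd.snd.prodMk hY.fst)))
  set C := par '' Icc s₁ s₂ with hCdef
  have hC : IsCompact C := isCompact_Icc.image_of_continuousOn hparc
  -- The degree M + 2 leaves a remainder O(|s|^(M+3)), more than needed, and is at least 2 even for
  -- M = 0.
  have h1 : VanishOrder C M fun q : Par n (M + 2) × Sp n => symbG f (M + 2) q -
      ∑ k ∈ Finset.range (M + 2 + 1), (k ! : ℝ)⁻¹ •
        iteratedFDeriv ℝ k (symbG f (M + 2)) (q.1, 0) fun _ => (0, q.2) :=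
    VanishOrder.mono (m := M + 2 + 1) (by omega) (exists_taylor_bound (contDiff_symbG hf) hC (M + 2))
  -- The orders N and M + 2 are both compared with M, so it does not matter which of them is larger.
  have h2 := ((vanishOrder_symbolTaylor_sub hf hC hN).sub
    (vanishOrder_symbolTaylor_sub hf hC (show M ≤ M + 2 by omega))).mono
    (show M ≤ M + 1 by omega)
  have hI : VanishOrder C 0 fun _ : Par n (M + 2) × Sp n => Complex.I :=
    ⟨1, fun p _ s _ => by simp⟩
  have h3 := hI.mul h2
  rw [zero_add] at h3
  obtain ⟨c, hc⟩ := h3.sub h1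
  refine ⟨c, fun t ht s hs => ?_⟩
  have htI : t ∈ Icc s₁ s₂ := Ioo_subset_Icc_self ht
  have het := he t htI
  have hcoef : ∀ α, HasDerivAt (fun t => ext (e t).2.2 α) (ext (field f (t, e t)).2.2 α) t := by
    intro α
    unfold ext
    split_ifs with hα
    · exact (hasDerivAt_pi.mp het.snd.snd) ⟨α, hα⟩
    · exact hasDerivAt_const _ _
  have hE := eikonalLHS_eq (K := M + 2) (N := N) f (hw₀ t ht) het.fst het.snd.fst hcoef s
  have hb := hc (par t) ⟨t, htI, rfl⟩ s hs
  refine le_of_eq_of_le ?_ hb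
  rw [hE]
  congr 1
  have hpoly : poly (M + 2) (ext (field f (t, e t)).2.2) s =
      ∑ k ∈ Finset.Icc 2 (M + 2), (k ! : ℝ)⁻¹ •
      iteratedFDeriv ℝ k (symbG f (M + 2)) (par t, 0) fun _ => (0, s) := by
    rw [← poly_coefG]
    exact poly_congr (fun α hα => ext_restrict (fun α => coefG f α (par t)) hα) s
  -- Degrees 0, 1 and ≥ 2 give the terms that cancel those from w₀', ξ₀' and the w_α'.
  have hsum : ∑ k ∈ Finset.range (M + 2 + 1), (k ! : ℝ)⁻¹ •
        (iteratedFDeriv ℝ k (symbG f (M + 2)) (par t, 0) fun _ => (0, s)) =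
      -(Complex.I * f (t, (e t).1, (e t).2.1)) +
        ((inner ℝ s (field f (t, e t)).2.1 : ℝ) : ℂ) +
        poly (M + 2) (ext (field f (t, e t)).2.2) s := by
    rw [hpoly, ← Finset.Ico_add_one_right_eq_Icc, Finset.range_eq_Ico,
      Finset.sum_eq_sum_Ico_succ_bot (by omega), Finset.sum_eq_sum_Ico_succ_bot (by omega),
      ← add_assoc]
    congr 2
    · rw [← symbG_zero (K := M + 2) f t (e t).1 (e t).2.1 (e t).2.2 (field f (t, e t)).1]
      simp [hpar]
    · have := iteratedFDeriv_one_symbG_field (by omega) hf t (e t).1 (e t).2.1 (e t).2.2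
        (hunit t htI) s
      simpa using this
  dsimp only
  rw [hsum]
  simp only [hpar, symbG]
  ring

/-! ### From a curve with a sign change to the phase -/

theorem exists_primitive {A B : ℝ} {g : ℝ → ℂ} (hg : ContDiffOn ℝ ∞ g (Ioo A B)) :
    ∃ G : ℝ → ℂ, ContDiffOn ℝ ∞ G (Ioo A B) ∧ ∀ t ∈ Ioo A B, HasDerivAt G (g t) t := by
  by_cases hAB : A < B
  swap
  · exact ⟨fun _ => 0, contDiffOn_const, fun t ht => absurd (ht.1.trans ht.2) hAB⟩
  have hm : (A + B) / 2 ∈ Ioo A B := ⟨by linarith, by linarith⟩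
  have hd : ∀ t ∈ Ioo A B, HasDerivAt (fun t => ∫ τ in ((A + B) / 2)..t, g τ) (g t) t := by
    intro t ht
    have hsub : uIcc ((A + B) / 2) t ⊆ Ioo A B := (ordConnected_Ioo).uIcc_subset hm ht
    exact intervalIntegral.integral_hasDerivAt_right
      ((hg.continuousOn.mono hsub).intervalIntegrable)
      (hg.continuousOn.stronglyMeasurableAtFilter isOpen_Ioo t ht)
      (hg.continuousOn.continuousAt (isOpen_Ioo.mem_nhds ht))
  refine ⟨_, ?_, hd⟩
  rw [contDiffOn_infty_iff_deriv_of_isOpen isOpen_Ioo]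
  exact ⟨fun t ht => (hd t ht).differentiableAt.differentiableWithinAt,
    hg.congr fun t ht => (hd t ht).deriv⟩

theorem isUnit_of_coercive {n : ℕ} {T : Sp n →L[ℝ] Sp n} {c : ℝ} (hc : 0 < c)
    (h : ∀ v, c * ‖v‖ ^ 2 ≤ inner ℝ (T v) v) : IsUnit T := by
  rw [ContinuousLinearMap.isUnit_iff_bijective]
  have hinj : Function.Injective T := by
    rw [injective_iff_map_eq_zero]
    intro v hv
    have := h v
    rw [hv, inner_zero_left] at this
    have h2 : ‖v‖ ^ 2 ≤ 0 := by nlinarith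
    exact norm_eq_zero.mp (pow_eq_zero_iff two_ne_zero |>.mp (le_antisymm h2 (by positivity)))
  exact ⟨hinj, (LinearMap.injective_iff_surjective (f := (T : Sp n →ₗ[ℝ] Sp n))).mp hinj⟩

theorem imW2_eq {n K : ℕ} (w : ℝ → Coef n K) (t : ℝ) (v : Sp n) :
    imW2 (fun α t => ext (w t) α) t v = inner ℝ (imOp (w t) v) v := by
  rw [imW2, PiLp.inner_apply]
  refine Finset.sum_congr rfl fun i _ => ?_
  simp only [imOp, opOf_apply, hess, RCLike.inner_apply, conj_trivial, Finset.mul_sum]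
  exact Finset.sum_congr rfl fun j _ => by ring

theorem exists_gt_of_hasDerivAt_neg {g : ℝ → ℝ} {g' t ε : ℝ} (hg : HasDerivAt g g' t)
    (hneg : g' < 0) (hε : 0 < ε) :
    (∃ s ∈ Ioo (t - ε) t, g t < g s) ∧ ∃ s ∈ Ioo t (t + ε), g s < g t := by
  have h := (hasDerivAt_iff_tendsto_slope.mp hg).eventually_lt_const hneg
  constructor
  · have h1 : ∀ᶠ s in 𝓝[<] t, slope g t s < 0 := h.filter_mono
      (nhdsWithin_mono _ fun x hx => ne_of_lt hx)
    obtain ⟨s, hs, hsI⟩ := (h1.and (Ioo_mem_nhdsLT (show t - ε < t by linarith))).exists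
    refine ⟨s, hsI, ?_⟩
    rw [slope_def_field, div_neg_iff] at hs
    rcases hs with hs | hs
    · linarith
    · linarith [hsI.2]
  · have h1 : ∀ᶠ s in 𝓝[>] t, slope g t s < 0 := h.filter_mono
      (nhdsWithin_mono _ fun x hx => ne_of_gt hx)
    obtain ⟨s, hs, hsI⟩ := (h1.and (Ioo_mem_nhdsGT (show t < t + ε by linarith))).exists
    refine ⟨s, hsI, ?_⟩
    rw [slope_def_field, div_neg_iff] at hs
    rcases hs with hs | hs
    · linarith [hsI.1]
    · linarith

/-- A function with derivative negative at `s` and positive at `t > s` has an interior minimum,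
which can be enclosed by two points where the function has a small prescribed excess. -/
theorem exists_min_level {h h' : ℝ → ℝ} {s t c₀ : ℝ} (hst : s < t)
    (hd : ∀ τ ∈ Icc s t, HasDerivAt h (h' τ) τ) (hs : h' s < 0) (ht : 0 < h' t) (hc₀ : 0 < c₀) :
    ∃ m t₁ t₂ c, 0 < c ∧ c ≤ c₀ ∧ s ≤ t₁ ∧ t₁ < m ∧ m < t₂ ∧ t₂ ≤ t ∧ h t₁ = h m + c ∧
      h t₂ = h m + c ∧ ∀ τ ∈ Icc s t, h m ≤ h τ := by
  have hcont : ContinuousOn h (Icc s t) := fun τ hτ => (hd τ hτ).continuousAt.continuousWithinAt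
  obtain ⟨m, hm, hmin⟩ := isCompact_Icc.exists_isMinOn (nonempty_Icc.mpr hst.le) hcont
  have hmin' : ∀ τ ∈ Icc s t, h m ≤ h τ := fun τ hτ => hmin hτ
  have h1 : h m < h s := by
    obtain ⟨-, τ, hτ, hlt⟩ := exists_gt_of_hasDerivAt_neg (hd s ⟨le_rfl, hst.le⟩) hs
      (sub_pos.mpr hst)
    exact (hmin' τ ⟨hτ.1.le, by linarith [hτ.2]⟩).trans_lt hlt
  have h2 : h m < h t := by
    have hneg : HasDerivAt (fun τ => -h τ) (-h' t) t := (hd t ⟨hst.le, le_rfl⟩).fun_neg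
    obtain ⟨⟨τ, hτ, hlt⟩, -⟩ := exists_gt_of_hasDerivAt_neg hneg (by linarith)
      (sub_pos.mpr hst)
    have := hmin' τ ⟨by linarith [hτ.1], hτ.2.le⟩
    linarith
  -- At most the excess of h over its minimum at both ends, so the level h m + c is attained on
  -- either side of m.
  set c := min c₀ (min (h s - h m) (h t - h m)) with hc
  have hcpos : 0 < c := lt_min hc₀ (lt_min (by linarith) (by linarith))
  have hcs : c ≤ h s - h m := (min_le_right _ _).trans (min_le_left _ _)
  have hct : c ≤ h t - h m := (min_le_right _ _).trans (min_le_right _ _)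
  obtain ⟨t₁, ht₁, e₁⟩ := intermediate_value_Icc' hm.1 (hcont.mono (Icc_subset_Icc_right hm.2))
    (show h m + c ∈ Icc (h m) (h s) from ⟨by linarith, by linarith⟩)
  obtain ⟨t₂, ht₂, e₂⟩ := intermediate_value_Icc hm.2 (hcont.mono (Icc_subset_Icc_left hm.1))
    (show h m + c ∈ Icc (h m) (h t) from ⟨by linarith, by linarith⟩)
  refine ⟨m, t₁, t₂, c, hcpos, min_le_left _ _, ht₁.1, ?_, ?_, ht₂.2, e₁, e₂, hmin'⟩
  · exact lt_of_le_of_ne ht₁.2 fun h0 => by rw [h0] at e₁; linarith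
  · exact lt_of_le_of_ne ht₂.1 fun h0 => by rw [← h0] at e₂; linarith

/-- An integral curve of `field f` along which `f` changes sign from `+` to `-` gives a phase. -/
theorem exists_phase_of_curve {n M : ℕ} {W U : Set (ℝ × Sp n × Sp n)} (hU : IsOpen U)
    (hUW : U ⊆ W) {f₀ f : ℝ × Sp n × Sp n → ℝ} (hf : ContDiff ℝ ∞ f) (hff : EqOn f₀ f U)
    {s₁ s₂ : ℝ} {e : ℝ → St n (M + 2)} (hes : ContDiffOn ℝ ∞ e (Ioo s₁ s₂))
    (he : ∀ t ∈ Icc s₁ s₂, HasDerivAt e (field f (t, e t)) t)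
    (heU : ∀ t ∈ Icc s₁ s₂, (t, (e t).1, (e t).2.1) ∈ U) {c₀ : ℝ} (hc₀ : 0 < c₀)
    (hc : ∀ t ∈ Icc s₁ s₂, ∀ v, c₀ * ‖v‖ ^ 2 ≤ inner ℝ (imOp (e t).2.2 v) v)
    {s t : ℝ} (hs : s₁ < s) (hst : s < t) (ht : t < s₂) (hpos : 0 < f (s, (e s).1, (e s).2.1))
    (hneg : f (t, (e t).1, (e t).2.1) < 0) :
    ∃ (K : ℕ) (t₁ t₂ r c : ℝ) (w₀ : ℝ → ℂ) (x₀ ξ₀ : ℝ → Sp n) (w : (Fin n → ℕ) → ℝ → ℂ),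
      2 ≤ K ∧ s₁ < t₁ ∧ t₁ < t₂ ∧ t₂ < s₂ ∧ 0 < r ∧ 0 < c ∧
      ContDiffOn ℝ ∞ w₀ (Ioo s₁ s₂) ∧ ContDiffOn ℝ ∞ x₀ (Ioo s₁ s₂) ∧
      ContDiffOn ℝ ∞ ξ₀ (Ioo s₁ s₂) ∧ (∀ α, ContDiffOn ℝ ∞ (w α) (Ioo s₁ s₂)) ∧
      (∀ t ∈ Ioo s₁ s₂, ∀ y, ‖y - x₀ t‖ < r → (t, y, ξ₀ t) ∈ W) ∧
      (∀ N, M ≤ N → ∃ C : ℝ, ∀ t ∈ Ioo s₁ s₂, ∀ y, ‖y - x₀ t‖ < r →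
        ‖eikonalLHS N f₀ ξ₀ (phase K w₀ x₀ ξ₀ w) t y‖ ≤ C * ‖y - x₀ t‖ ^ M) ∧
      (∀ t ∈ Icc t₁ t₂, ∀ v, c * ‖v‖ ^ 2 ≤ imW2 w t v) ∧
      IsLeast ((fun t => (w₀ t).im) '' Ioo t₁ t₂) 0 ∧ (w₀ t₁).im = c ∧ (w₀ t₂).im = c := by
  have hunit : ∀ t ∈ Icc s₁ s₂, IsUnit (imOp (e t).2.2) := fun t ht =>
    isUnit_of_coercive hc₀ (hc t ht)
  have hIoo : Ioo s₁ s₂ ⊆ Icc s₁ s₂ := Ioo_subset_Icc_self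
  have hes1 : ContDiffOn ℝ ∞ (fun t => (e t).1) (Ioo s₁ s₂) := contDiff_fst.comp_contDiffOn hes
  have hes2 : ContDiffOn ℝ ∞ (fun t => (e t).2.1) (Ioo s₁ s₂) :=
    (contDiff_fst.comp contDiff_snd).comp_contDiffOn hes
  have hes3 : ContDiffOn ℝ ∞ (fun t => (e t).2.2) (Ioo s₁ s₂) :=
    (contDiff_snd.comp contDiff_snd).comp_contDiffOn hes
  have hgs : ContDiffOn ℝ ∞ (fun t => ((inner ℝ (field f (t, e t)).1 (e t).2.1 : ℝ) : ℂ) -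
      Complex.I * f (t, (e t).1, (e t).2.1)) (Ioo s₁ s₂) := by
    have hF : ContDiffOn ℝ ∞ (fun t => field f (t, e t)) (Ioo s₁ s₂) := by
      intro t ht
      exact (contDiffAt_field hf (p := (t, e t)) (hunit t (hIoo ht))).comp_contDiffWithinAt
        (f := fun t => (t, e t)) t (contDiffWithinAt_id.prodMk (hes t ht))
    refine ContDiffOn.sub ?_ (contDiffOn_const.mul ?_)
    · exact Complex.ofRealCLM.contDiff.comp_contDiffOn
        ((contDiff_fst.comp_contDiffOn hF).inner ℝ hes2)
    · exact Complex.ofRealCLM.contDiff.comp_contDiffOn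
        (hf.comp_contDiffOn (contDiffOn_id.prodMk (hes1.prodMk hes2)))
  obtain ⟨G, hGs, hG⟩ := exists_primitive hgs
  have hst' : Icc s t ⊆ Ioo s₁ s₂ := fun τ hτ => ⟨hs.trans_le hτ.1, hτ.2.trans_lt ht⟩
  -- As ⟨x₀', ξ₀⟩ is real, Im w₀' = -f. The excess c is kept below c₀ so that it also serves as the
  -- lower bound for Im w₂.
  obtain ⟨m, t₁, t₂, c, hcpos, hcc₀, hst₁, ht₁m, hmt₂, ht₂t, e₁, e₂, hmin⟩ :=
    exists_min_level (h := fun τ => (G τ).im) (h' := fun τ => -f (τ, (e τ).1, (e τ).2.1))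
      hst (by
        intro τ hτ
        have := (Complex.imCLM.hasFDerivAt.comp_hasDerivAt τ (hG τ (hst' hτ)))
        simpa [Function.comp_def] using this) (by simpa using hpos) (by simpa using hneg) hc₀
  -- An imaginary constant is subtracted to make the minimum 0; w₀' is unaffected.
  have hGs' : ContDiffOn ℝ ∞ (fun t => G t - Complex.I * ((G m).im : ℂ)) (Ioo s₁ s₂) :=
    hGs.sub contDiffOn_const
  have hec : ContinuousOn (fun t => (t, (e t).1, (e t).2.1)) (Icc s₁ s₂) := by
    have hc' : ContinuousOn e (Icc s₁ s₂) := fun t ht => (he t ht).continuousAt.continuousWithinAt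
    exact continuousOn_id.prodMk (hc'.fst.prodMk hc'.snd.fst)
  obtain ⟨δ, hδ, hδU⟩ := (isCompact_Icc.image_of_continuousOn hec).exists_thickening_subset_open hU
    (by rintro _ ⟨t, ht, rfl⟩; exact heU t ht)
  -- The radius δ keeps the tube in U, and 1 is the radius within which the Taylor bounds hold.
  have htube : ∀ t ∈ Icc s₁ s₂, ∀ y, ‖y - (e t).1‖ < min δ 1 → (t, y, (e t).2.1) ∈ U := by
    intro t ht y hy
    refine hδU (Metric.mem_thickening_iff.mpr ⟨_, ⟨t, ht, rfl⟩, ?_⟩)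
    simp only [Prod.dist_eq, dist_self]
    rw [max_eq_left dist_nonneg, max_eq_right dist_nonneg, dist_eq_norm]
    exact hy.trans_le (min_le_left _ _)
  refine ⟨M + 2, t₁, t₂, min δ 1, c, fun t => G t - Complex.I * ((G m).im : ℂ),
    fun t => (e t).1, fun t => (e t).2.1, fun α t => ext (e t).2.2 α, by omega, by linarith,
    by linarith, by linarith, lt_min hδ one_pos, hcpos, hGs', hes1, hes2, ?_, ?_, ?_, ?_, ?_, ?_, ?_⟩
  · exact fun α => (contDiff_ext α).comp_contDiffOn hes3
  · exact fun t ht y hy => hUW (htube t (hIoo ht) y hy)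
  · intro N hN
    obtain ⟨C, hC⟩ := exists_eikonal_bound hf he hunit
      (w₀ := fun t => G t - Complex.I * ((G m).im : ℂ)) (fun t ht => (hG t ht).sub_const _) hN
    refine ⟨C, fun t ht y hy => ?_⟩
    have h1 := hC t ht (y - (e t).1) (hy.le.trans (min_le_right _ _))
    rw [add_sub_cancel] at h1
    have h2 := htube t (hIoo ht) y hy
    unfold eikonalLHS at h1 ⊢
    rwa [symbolTaylor_congr hU hff h2]
  · intro τ hτ v
    rw [imW2_eq (fun t => (e t).2.2)]
    refine le_trans ?_ (hc τ ⟨by linarith [hτ.1], by linarith [hτ.2]⟩ v)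
    gcongr
  · constructor
    · exact ⟨m, ⟨ht₁m, hmt₂⟩, by simp⟩
    · rintro _ ⟨τ, hτ, rfl⟩
      have := hmin τ ⟨by linarith [hτ.1], by linarith [hτ.2]⟩
      simpa using this
  · simpa [sub_eq_iff_eq_add, add_comm] using e₁
  · simpa [sub_eq_iff_eq_add, add_comm] using e₂

/-! ### Integral curves near an equilibrium -/

/-- Grönwall comparison with the constant curve z. If a < b, then v(·, z) vanishes on [a, b] and is
at most K δ on the enlarged interval; if a = b, the time span is at most 2 δ. Either way the
deviation is O(δ). -/
theorem exists_stay_near {Z : Type*} [NormedAddCommGroup Z] [NormedSpace ℝ Z] {v : ℝ × Z → Z}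
    {K : ℝ≥0} (hv : LipschitzWith K v) {L : ℝ} (hL : ∀ p, ‖v p‖ ≤ L) {a b : ℝ} (hab : a ≤ b)
    {z : Z} (hz : a < b → ∀ t ∈ Icc a b, v (t, z) = 0) {η : ℝ} (hη : 0 < η) :
    ∃ δ > 0, δ ≤ 1 ∧ ∀ γ, IsTraj v (a - 2) (b + 2) γ → ∀ t₀ ∈ Icc (a - δ) (b + δ),
      dist (γ t₀) z < δ → ∀ t ∈ Icc (a - δ) (b + δ), dist (γ t) z < η := by
  have hL0 : 0 ≤ L := (norm_nonneg _).trans (hL (0, z))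
  set D : ℝ := 1 + K * (b - a + 2) + L * 2 with hD
  have hD0 : 0 < D := by
    have : 0 ≤ (K : ℝ) * (b - a + 2) := mul_nonneg K.2 (by linarith)
    linarith
  set E := Real.exp (K * (b - a + 2)) with hE
  have hE0 : 0 < E := Real.exp_pos _
  set δ := min 1 (η / (2 * (D * E))) with hδ
  have hδ0 : 0 < δ := lt_min one_pos (by positivity)
  have hδ1 : δ ≤ 1 := min_le_left _ _
  refine ⟨δ, hδ0, hδ1, fun γ hγ t₀ ht₀ hd t ht => ?_⟩
  have hI : Icc (a - δ) (b + δ) ⊆ Ioo (a - 2) (b + 2) := fun τ hτ =>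
    ⟨by linarith [hτ.1], by linarith [hτ.2]⟩
  have habs : |t - t₀| ≤ b - a + 2 * δ := by
    rw [abs_le]
    constructor <;> linarith [ht.1, ht.2, ht₀.1, ht₀.2]
  have habs' : |t - t₀| ≤ b - a + 2 := by linarith
  obtain ⟨ε, hε0, hε, hεD⟩ : ∃ ε : ℝ, 0 ≤ ε ∧ (∀ τ ∈ Icc (a - δ) (b + δ), ‖v (τ, z)‖ ≤ ε) ∧
      ε * |t - t₀| ≤ (K * (b - a + 2) + L * 2) * δ := by
    rcases hab.eq_or_lt with rfl | hlt
    · refine ⟨L, hL0, fun τ _ => hL _, ?_⟩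
      have h1 : L * |t - t₀| ≤ L * (2 * δ) := by gcongr; linarith
      have h2 : 0 ≤ (K : ℝ) * (a - a + 2) * δ := by
        have := K.2
        have h3 : (0 : ℝ) ≤ a - a + 2 := by linarith
        positivity
      linarith
    · refine ⟨K * δ, by positivity, fun τ hτ => ?_, ?_⟩
      -- The nearest point of [a, b] to τ, at distance at most δ.
      · have hτ' : max a (min b τ) ∈ Icc a b := ⟨le_max_left _ _, max_le hab (min_le_left _ _)⟩
        have h1 := hv.dist_le_mul (τ, z) (max a (min b τ), z)
        rw [hz hlt _ hτ', dist_zero_right, Prod.dist_eq, dist_self, max_eq_left dist_nonneg] at h1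
        refine h1.trans ?_
        gcongr
        rw [Real.dist_eq, abs_le]
        have h2 := hτ.1
        have h3 := hτ.2
        constructor
        · have : max a (min b τ) ≤ τ + δ := max_le (by linarith) ((min_le_right _ _).trans
            (by linarith))
          linarith
        · rcases le_total b τ with h | h
          · rw [min_eq_left h, max_eq_right hab]
            linarith
          · rw [min_eq_right h]
            linarith [le_max_right a τ]
      · have h1 : (K : ℝ) * δ * |t - t₀| ≤ K * δ * (b - a + 2) := by gcongr
        have h2 : 0 ≤ L * 2 * δ := by positivity
        linarith
  have h1 := hγ.dist_le hv (g := fun _ => z) (g' := fun _ => 0) (ε := ε)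
    (fun τ _ => hasDerivAt_const τ z) (hI ht₀) (hI ht) (fun τ hτ => by
      rw [dist_zero_left]
      exact hε τ (ordConnected_Icc.uIcc_subset ht₀ ht hτ))
  have h2 : Real.exp (K * |t - t₀|) ≤ E := by
    rw [hE]
    gcongr
  have h3 : (dist (γ t₀) z + ε * |t - t₀|) * Real.exp (K * |t - t₀|) ≤ D * δ * E := by
    have h4 : dist (γ t₀) z + ε * |t - t₀| ≤ D * δ := by
      rw [hD]; linarith
    exact mul_le_mul h4 h2 (Real.exp_pos _).le (by positivity)
  refine h1.trans_lt (h3.trans_lt ?_)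
  have h5 : δ ≤ η / (2 * (D * E)) := min_le_right _ _
  rw [le_div_iff₀ (by positivity)] at h5
  nlinarith

theorem exists_tube {Z : Type*} [NormedAddCommGroup Z] {O : Set (ℝ × Z)} (hO : IsOpen O)
    {a b : ℝ} {z : Z} (h : ∀ t ∈ Icc a b, (t, z) ∈ O) (hab : a ≤ b) :
    ∃ η > 0, ∀ t ∈ Icc (a - η) (b + η), ∀ z', dist z' z < η → (t, z') ∈ O := by
  have hc : IsCompact ((fun t : ℝ => (t, z)) '' Icc a b) := isCompact_Icc.image (by fun_prop)
  obtain ⟨δ, hδ, hδO⟩ := hc.exists_thickening_subset_open hO (by rintro _ ⟨t, ht, rfl⟩; exact h t ht)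
  refine ⟨δ / 2, by positivity, fun t ht z' hz' => hδO (Metric.mem_thickening_iff.mpr ?_)⟩
  refine ⟨_, ⟨max a (min b t), ⟨le_max_left _ _, max_le hab (min_le_left _ _)⟩, rfl⟩, ?_⟩
  rw [Prod.dist_eq]
  refine max_lt ?_ (by dsimp only; linarith)
  dsimp only
  rw [Real.dist_eq, abs_lt]
  have h2 := ht.1
  have h3 := ht.2
  constructor
  · have : max a (min b t) ≤ t + δ / 2 := max_le (by linarith) ((min_le_right _ _).trans
      (by linarith))
    linarith
  · rcases le_total b t with h | h
    · rw [min_eq_left h, max_eq_right hab]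
      linarith
    · rw [min_eq_right h]
      linarith [le_max_right a t]

/-! ### Choice of the initial phase -/

/-- The multi-index e_i + e_j determines the unordered pair {i, j}, so by symmetry of a the choice
of an ordered pair is harmless. -/
theorem exists_hess_eq {n K : ℕ} (hK : 2 ≤ K) {a : Fin n → Fin n → ℂ}
    (ha : ∀ i j, a i j = a j i) : ∃ w : Coef n K, ∀ i j, hess (ext w) i j = a i j := by
  classical
  let w : (Fin n → ℕ) → ℂ := fun α =>
    if h : ∃ p : Fin n × Fin n, (Pi.single p.1 1 + Pi.single p.2 1 : Fin n → ℕ) = α then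
      a h.choose.1 h.choose.2 else 0
  refine ⟨fun α => w α, fun i j => ?_⟩
  rw [hess, ext_restrict w (single_add_single_mem_idx hK i j)]
  have h : ∃ p : Fin n × Fin n, (Pi.single p.1 1 + Pi.single p.2 1 : Fin n → ℕ) =
      Pi.single i 1 + Pi.single j 1 := ⟨(i, j), rfl⟩
  simp only [w, dif_pos h]
  have h2 := h.choose_spec
  rw [Pi.single_add_single_eq_single_add_single one_ne_zero one_ne_zero] at h2
  rcases h2 with ⟨h3, h4⟩ | ⟨-, h3, h4⟩ | ⟨h3, -⟩
  · rw [h3, h4]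
  · rw [h3, h4, ha]
  · exact absurd h3 (by norm_num)

theorem exists_coef {n K : ℕ} (hK : 2 ≤ K) {a : Fin n → Fin n → ℝ} (ha : ∀ i j, a i j = a j i)
    (β : ℝ) : ∃ w : Coef n K, reOp w = opOf a ∧ ∀ v, imOp w v = β • v := by
  obtain ⟨w, hw⟩ := exists_hess_eq hK
    (a := fun i j => (⟨a i j, if i = j then β else 0⟩ : ℂ)) fun i j => by
      simp [ha i j, eq_comm]
  refine ⟨w, ?_, fun v => ?_⟩
  · simp [reOp, hw]
  · ext i
    rw [imOp, opOf_apply]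
    simp [hw]

/-- The symmetrized rank-one matrix (g uᵀ + u gᵀ)/|u|² sends u to g plus a multiple of u, which the
term in u uᵀ removes. -/
theorem exists_symm_opOf {n : ℕ} {u g : Sp n} (hu : u ≠ 0) :
    ∃ a : Fin n → Fin n → ℝ, (∀ i j, a i j = a j i) ∧ opOf a u = g := by
  set N : ℝ := ∑ j, u j * u j with hN
  set d : ℝ := ∑ j, g j * u j with hd
  have hN0 : N ≠ 0 := by
    have h1 : N = ‖u‖ ^ 2 := by
      rw [EuclideanSpace.real_norm_sq_eq]
      exact Finset.sum_congr rfl fun j _ => by ring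
    rw [h1]
    exact pow_ne_zero 2 (norm_ne_zero_iff.mpr hu)
  refine ⟨fun i j => (g i * u j + u i * g j) / N - d * u i * u j / N ^ 2,
    fun i j => by ring, ?_⟩
  ext i
  rw [opOf_apply]
  have h1 : ∀ j, ((g i * u j + u i * g j) / N - d * u i * u j / N ^ 2) * u j =
      g i / N * (u j * u j) + u i / N * (g j * u j) - d * u i / N ^ 2 * (u j * u j) :=
    fun j => by ring
  simp only [h1, Finset.sum_sub_distrib, Finset.sum_add_distrib, ← Finset.mul_sum, ← hN, ← hd]
  field_simp
  ring

/-! ### Localization of the vector field -/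

/-- The value of the symbol at a state. -/
def symbSt {n K : ℕ} (f : ℝ × Sp n × Sp n → ℝ) (p : ℝ × St n K) : ℝ := f (p.1, p.2.1, p.2.2.1)

theorem contDiff_symbSt {n K : ℕ} {f : ℝ × Sp n × Sp n → ℝ} (hf : ContDiff ℝ ∞ f) :
    ContDiff ℝ ∞ (symbSt (K := K) f) := hf.comp (by fun_prop)

theorem fderiv_symbSt {n K : ℕ} {f : ℝ × Sp n × Sp n → ℝ} (hf : ContDiff ℝ ∞ f)
    (p q : ℝ × St n K) : fderiv ℝ (symbSt f) p q =
      fderiv ℝ f (p.1, p.2.1, p.2.2.1) (q.1, q.2.1, q.2.2.1) := by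
  set L : ℝ × St n K →L[ℝ] ℝ × Sp n × Sp n :=
    (ContinuousLinearMap.fst ℝ ℝ (St n K)).prod
      (((ContinuousLinearMap.fst ℝ (Sp n) (Sp n × Coef n K)).comp
        (ContinuousLinearMap.snd ℝ ℝ (St n K))).prod
      ((ContinuousLinearMap.fst ℝ (Sp n) (Coef n K)).comp
        ((ContinuousLinearMap.snd ℝ (Sp n) (Sp n × Coef n K)).comp
          (ContinuousLinearMap.snd ℝ ℝ (St n K))))) with hL
  have h1 : HasFDerivAt f (fderiv ℝ f (L p)) (L p) :=
    (hf.differentiable (by simp) _).hasFDerivAt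
  have h2 : HasFDerivAt (symbSt (K := K) f) _ p := h1.comp p L.hasFDerivAt
  rw [h2.fderiv]
  rfl

theorem fderiv_split {n : ℕ} (f : ℝ × Sp n × Sp n → ℝ) (p : ℝ × Sp n × Sp n) (y η : Sp n) :
    fderiv ℝ f p (1, y, η) = fderiv ℝ f p (1, 0, 0) + inner ℝ (gradX f p) y +
      inner ℝ (gradXi f p) η := by
  have h : ((1, y, η) : ℝ × Sp n × Sp n) = (1, 0, 0) + (0, y, 0) + (0, 0, η) := by simp
  rw [h, map_add, map_add, fderiv_x_eq, fderiv_xi_eq, PiLp.inner_apply, PiLp.inner_apply]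
  simp [mul_comm]

theorem coercive_of_norm_sub_lt {n : ℕ} {T T₀ : Sp n →L[ℝ] Sp n} {β : ℝ}
    (hT₀ : ∀ v, T₀ v = β • v) (h : ‖T - T₀‖ < β / 2) (x : Sp n) :
    β / 2 * ‖x‖ ^ 2 ≤ inner ℝ (T x) x := by
  have h1 : T x = β • x + (T - T₀) x := by
    rw [_root_.sub_apply, hT₀]; abel
  have h2 : |inner ℝ ((T - T₀) x) x| ≤ β / 2 * ‖x‖ ^ 2 := by
    refine (abs_real_inner_le_norm _ _).trans ?_
    have h3 := (T - T₀).le_opNorm x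
    have h4 : ‖T - T₀‖ * ‖x‖ ≤ β / 2 * ‖x‖ := mul_le_mul_of_nonneg_right h.le (norm_nonneg x)
    calc ‖(T - T₀) x‖ * ‖x‖ ≤ β / 2 * ‖x‖ * ‖x‖ :=
          mul_le_mul_of_nonneg_right (h3.trans h4) (norm_nonneg x)
      _ = β / 2 * ‖x‖ ^ 2 := by ring
  rw [h1, inner_add_left, real_inner_smul_left, real_inner_self_eq_norm_sq]
  linarith [(abs_le.mp h2).1]

theorem isOpen_setOf_norm_imOp_sub_lt {n K : ℕ} {U : Set (ℝ × Sp n × Sp n)} (hU : IsOpen U)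
    (T₀ : Sp n →L[ℝ] Sp n) (β : ℝ) :
    IsOpen {p : ℝ × St n K | (p.1, p.2.1, p.2.2.1) ∈ U ∧ ‖imOp p.2.2.2 - T₀‖ < β} := by
  have h1 : Continuous fun p : ℝ × St n K => (p.1, p.2.1, p.2.2.1) := by fun_prop
  have h2 : Continuous fun p : ℝ × St n K => p.2.2.2 := by fun_prop
  have h3 : Continuous fun p : ℝ × St n K => ‖imOp p.2.2.2 - T₀‖ :=
    ((contDiff_imOp.continuous.comp h2).sub continuous_const).norm
  exact (hU.preimage h1).inter (isOpen_lt h3 continuous_const)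

/-- A compactly supported vector field that agrees with `field f` near a segment. -/
theorem exists_cutoff_field {n K : ℕ} {f : ℝ × Sp n × Sp n → ℝ} (hf : ContDiff ℝ ∞ f)
    {U : Set (ℝ × Sp n × Sp n)} (hU : IsOpen U) {a b : ℝ} (hab : a ≤ b) {z : St n K}
    (hz : ∀ t ∈ Icc a b, (t, z.1, z.2.1) ∈ U) {β : ℝ} (hβ : 0 < β)
    (hzβ : ∀ v, imOp z.2.2 v = β • v) :
    ∃ (v : ℝ × St n K → St n K) (η : ℝ), ContDiff ℝ ∞ v ∧ HasCompactSupport v ∧ 0 < η ∧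
      ∀ t ∈ Icc (a - η) (b + η), ∀ z', dist z' z < η → v (t, z') = field f (t, z') ∧
        (t, z'.1, z'.2.1) ∈ U ∧ ∀ x, β / 2 * ‖x‖ ^ 2 ≤ inner ℝ (imOp z'.2.2 x) x := by
  -- On O the imaginary Hessian is within β/2 of β times the identity, hence coercive and
  -- invertible, so the field is smooth there.
  obtain ⟨O, hOopen, hO⟩ : ∃ O : Set (ℝ × St n K), IsOpen O ∧ ∀ p, p ∈ O ↔
      (p.1, p.2.1, p.2.2.1) ∈ U ∧ ‖imOp p.2.2.2 - imOp z.2.2‖ < β / 2 :=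
    ⟨_, isOpen_setOf_norm_imOp_sub_lt hU (imOp z.2.2) (β / 2), fun _ => Iff.rfl⟩
  have hcoer : ∀ p ∈ O, ∀ x, β / 2 * ‖x‖ ^ 2 ≤ inner ℝ (imOp p.2.2.2 x) x :=
    fun p hp => coercive_of_norm_sub_lt hzβ ((hO p).mp hp).2
  have hmem : ∀ t ∈ Icc a b, (t, z) ∈ O := fun t ht => (hO _).mpr ⟨hz t ht, by
    rw [sub_self, norm_zero]; exact half_pos hβ⟩
  have hcont : Continuous fun t : ℝ => (t, z) := by fun_prop
  have hsub : (fun t : ℝ => (t, z)) '' Icc a b ⊆ O := by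
    rintro _ ⟨t, ht, rfl⟩; exact hmem t ht
  have hfield : ContDiffOn ℝ ∞ (field f) O := fun p hp => (contDiffAt_field hf
      (isUnit_of_coercive (half_pos hβ) (hcoer p hp))).contDiffWithinAt
  obtain ⟨v, hv, hvc, O', hO', hKO', hO'O, hEq⟩ := exists_contDiff_hasCompactSupport_eqOn hOopen
    (isCompact_Icc.image hcont) hsub hfield
  obtain ⟨η, hη, htube⟩ := exists_tube hO' (fun t ht => hKO' ⟨t, ht, rfl⟩) hab
  refine ⟨v, η, hv, hvc, hη, fun t ht z' hz' => ?_⟩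
  have h1 : (t, z') ∈ O' := htube t ht z' hz'
  have h2 : (t, z') ∈ O := hO'O h1
  exact ⟨hEq h1, ((hO (t, z')).mp h2).1, hcoer (t, z') h2⟩

/-! ### Integral curves along which the symbol changes sign -/

/-- If `f` is decreasing in time at a zero, then `f` changes sign from `+` to `-` along some short
integral curve of `field f`. -/
theorem exists_curve_of_fderiv_neg {n M : ℕ} {f : ℝ × Sp n × Sp n → ℝ} (hf : ContDiff ℝ ∞ f)
    {U : Set (ℝ × Sp n × Sp n)} (hU : IsOpen U) {p : ℝ × Sp n × Sp n} (hp : p ∈ U)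
    (hp0 : f p = 0) (hneg : fderiv ℝ f p (1, 0, 0) < 0) :
    ∃ (s₁ s₂ : ℝ) (e : ℝ → St n (M + 2)) (c₀ s t : ℝ), 0 < c₀ ∧
      ContDiffOn ℝ ∞ e (Ioo s₁ s₂) ∧ (∀ t ∈ Icc s₁ s₂, HasDerivAt e (field f (t, e t)) t) ∧
      (∀ t ∈ Icc s₁ s₂, (t, (e t).1, (e t).2.1) ∈ U) ∧
      (∀ t ∈ Icc s₁ s₂, ∀ v, c₀ * ‖v‖ ^ 2 ≤ inner ℝ (imOp (e t).2.2 v) v) ∧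
      s₁ < s ∧ s < t ∧ t < s₂ ∧ 0 < f (s, (e s).1, (e s).2.1) ∧
      f (t, (e t).1, (e t).2.1) < 0 := by
  obtain ⟨T, x, ξ⟩ := p
  set θ := fderiv ℝ f (T, x, ξ) (1, 0, 0) with hθ
  -- The expression required to be negative is the derivative of f at p along `field f`; it depends
  -- on the Hessian, which is free to be chosen.
  have hw : ∃ (w : Coef n (M + 2)) (β : ℝ), 0 < β ∧ (∀ v, imOp w v = β • v) ∧
      θ + inner ℝ (gradX f (T, x, ξ)) (velY f (T, x, ξ, w)) + inner ℝ (gradXi f (T, x, ξ))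
        (reOp w (velY f (T, x, ξ, w)) + imOp w (gradXi f (T, x, ξ))) < 0 := by
    by_cases hξ : gradXi f (T, x, ξ) = 0
    -- With ∂_ξ f = 0 and zero real Hessian the velocity is ∂_x f / β. It contributes |∂_x f|²/β,
    -- which is less than -θ for this large β.
    · set β := (‖gradX f (T, x, ξ)‖ ^ 2 + 1) / (-θ) with hβ
      have hβ0 : 0 < β := div_pos (by positivity) (by linarith)
      obtain ⟨w, hre, him⟩ := exists_coef (n := n) (K := M + 2) (by omega) (a := fun _ _ => 0)
        (fun _ _ => rfl) β
      refine ⟨w, β, hβ0, him, ?_⟩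
      have hu : IsUnit (imOp w) := isUnit_of_coercive hβ0 fun v => by
        rw [him, real_inner_smul_left, real_inner_self_eq_norm_sq]
      have hY := imOp_velY f (p := (T, x, ξ, w)) hu
      dsimp only at hY
      rw [him, hξ, map_zero, add_zero] at hY
      rw [hξ, inner_zero_left, add_zero]
      have h1 : β * inner ℝ (gradX f (T, x, ξ)) (velY f (T, x, ξ, w)) =
          ‖gradX f (T, x, ξ)‖ ^ 2 := by
        rw [← real_inner_smul_right, hY, real_inner_self_eq_norm_sq]
      have h2 : β * (-θ) = ‖gradX f (T, x, ξ)‖ ^ 2 + 1 := by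
        rw [hβ, div_mul_cancel₀ _ (by linarith)]
      by_contra hcon
      push Not at hcon
      have := mul_nonneg hβ0.le hcon
      linarith
    -- A real Hessian that sends ∂_ξ f to -∂_x f makes the velocity zero. Only β |∂_ξ f|² is left,
    -- and the small β below makes it less than -θ.
    · obtain ⟨a, ha, hau⟩ := exists_symm_opOf (g := -gradX f (T, x, ξ)) hξ
      set β := (-θ) / (‖gradXi f (T, x, ξ)‖ ^ 2 + 1) with hβ
      have hβ0 : 0 < β := div_pos (by linarith) (by positivity)
      obtain ⟨w, hre, him⟩ := exists_coef (n := n) (K := M + 2) (by omega) ha β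
      refine ⟨w, β, hβ0, him, ?_⟩
      have hu : IsUnit (imOp w) := isUnit_of_coercive hβ0 fun v => by
        rw [him, real_inner_smul_left, real_inner_self_eq_norm_sq]
      have hY : velY f (T, x, ξ, w) = 0 := by
        simp [velY, hre, hau]
      rw [hY, map_zero, inner_zero_right, zero_add, him, real_inner_smul_right,
        real_inner_self_eq_norm_sq]
      have h2 : β * (‖gradXi f (T, x, ξ)‖ ^ 2 + 1) = -θ := by
        rw [hβ, div_mul_cancel₀ _ (by positivity)]
      linarith
  obtain ⟨w, β, hβ, him, hlt⟩ := hw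
  obtain ⟨v, η, hv, hvc, hη, hloc⟩ := exists_cutoff_field hf hU (le_refl T) (z := (x, ξ, w))
    (fun t ht => by rw [Icc_self] at ht; rw [ht]; exact hp) hβ him
  obtain ⟨K, hK⟩ := hv.lipschitzWith_of_hasCompactSupport hvc (by simp)
  obtain ⟨L, hL⟩ := hvc.exists_bound_of_continuous hv.continuous
  obtain ⟨δ, hδ, hδ1, hstay⟩ := exists_stay_near hK hL (le_refl T) (z := (x, ξ, w))
    (fun h => absurd h (lt_irrefl T)) hη
  have hT2 : T ∈ Ioo (T - 2) (T + 2) := ⟨by linarith, by linarith⟩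
  obtain ⟨e, he0, he⟩ := exists_isTraj hK hL hT2 (x, ξ, w)
  set ε := min δ η with hε
  have hε0 : 0 < ε := lt_min hδ hη
  have hεδ : ε ≤ δ := min_le_left _ _
  have hεη : ε ≤ η := min_le_right _ _
  have hI : Icc (T - ε) (T + ε) ⊆ Ioo (T - 2) (T + 2) := fun t ht =>
    ⟨by linarith [ht.1], by linarith [ht.2]⟩
  have hall : ∀ t ∈ Icc (T - ε) (T + ε), _ := fun t ht =>
    hloc t ⟨by linarith [ht.1], by linarith [ht.2]⟩ (e t)
      (hstay e he T ⟨by linarith, by linarith⟩ (by rw [he0, dist_self]; exact hδ) t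
        ⟨by linarith [ht.1], by linarith [ht.2]⟩)
  have hder : HasDerivAt (fun t => symbSt f (t, e t)) (θ + inner ℝ (gradX f (T, x, ξ))
      (velY f (T, x, ξ, w)) + inner ℝ (gradXi f (T, x, ξ))
        (reOp w (velY f (T, x, ξ, w)) + imOp w (gradXi f (T, x, ξ)))) T := by
    have h1 : HasFDerivAt (symbSt (K := M + 2) f) (fderiv ℝ (symbSt f) (T, e T)) (T, e T) :=
      ((contDiff_symbSt hf).differentiable (by simp) _).hasFDerivAt
    have h2 := h1.comp_hasDerivAt T ((hasDerivAt_id T).prodMk (he T hT2))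
    rw [(hall T ⟨by linarith, by linarith⟩).1, fderiv_symbSt hf, he0] at h2
    dsimp only at h2
    rw [fderiv_split] at h2
    exact h2
  obtain ⟨⟨s, hs, hs'⟩, t, ht, ht'⟩ := exists_gt_of_hasDerivAt_neg hder hlt hε0
  have hT0 : symbSt f (T, e T) = 0 := by
    rw [he0]; exact hp0
  rw [hT0] at hs' ht'
  exact ⟨T - ε, T + ε, e, β / 2, s, t, by positivity,
    (he.contDiffOn hv).mono (Ioo_subset_Icc_self.trans hI),
    fun t ht => (hall t ht).1 ▸ he t (hI ht), fun t ht => (hall t ht).2.1,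
    fun t ht => (hall t ht).2.2, hs.1, hs.2.trans ht.1, ht.2, hs', ht'⟩

/-- If `f` is nondecreasing in time at its zeros, but changes sign from `+` to `-` near `[a, b]`,
then it also changes sign along an integral curve of `field f` defined in a neighborhood
of `[a, b]`. -/
theorem exists_curve_of_fderiv_nonneg {n M : ℕ} {f : ℝ × Sp n × Sp n → ℝ} (hf : ContDiff ℝ ∞ f)
    {U : Set (ℝ × Sp n × Sp n)} (hU : IsOpen U) {a b : ℝ} (hab : a ≤ b) {x ξ : Sp n}
    (hUab : ∀ t ∈ Icc a b, (t, x, ξ) ∈ U) (hflat : a < b → ∀ t ∈ Icc a b, Flat f (t, x, ξ))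
    (hmono : ∀ p ∈ U, f p = 0 → 0 ≤ fderiv ℝ f p (1, 0, 0))
    (hsign : ChangesSignNear (fun t => f (t, x, ξ)) a b) :
    ∃ (s₁ s₂ : ℝ) (e : ℝ → St n (M + 2)) (c₀ s t : ℝ), 0 < c₀ ∧
      ContDiffOn ℝ ∞ e (Ioo s₁ s₂) ∧ (∀ t ∈ Icc s₁ s₂, HasDerivAt e (field f (t, e t)) t) ∧
      (∀ t ∈ Icc s₁ s₂, (t, (e t).1, (e t).2.1) ∈ U) ∧
      (∀ t ∈ Icc s₁ s₂, ∀ v, c₀ * ‖v‖ ^ 2 ≤ inner ℝ (imOp (e t).2.2 v) v) ∧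
      s₁ < s ∧ s < t ∧ t < s₂ ∧ 0 < f (s, (e s).1, (e s).2.1) ∧
      f (t, (e t).1, (e t).2.1) < 0 ∧ Icc a b ⊆ Ioo s₁ s₂ := by
  obtain ⟨w, -, him⟩ := exists_coef (n := n) (K := M + 2) (by omega) (a := fun _ _ => 0)
    (fun _ _ => rfl) 1
  set z : St n (M + 2) := (x, ξ, w) with hz
  obtain ⟨v, η, hv, hvc, hη, hloc⟩ := exists_cutoff_field hf hU hab (z := z) hUab one_pos him
  obtain ⟨K, hK⟩ := hv.lipschitzWith_of_hasCompactSupport hvc (by simp)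
  obtain ⟨L, hL⟩ := hvc.exists_bound_of_continuous hv.continuous
  -- P keeps only the coefficient component, so curves of u = P ∘ v have constant (y, η) and the
  -- assumed sign change at (x, ξ) takes place along one of them.
  set P : St n (M + 2) →L[ℝ] St n (M + 2) :=
    (0 : St n (M + 2) →L[ℝ] Sp n).prod ((0 : St n (M + 2) →L[ℝ] Sp n).prod
      ((ContinuousLinearMap.snd ℝ (Sp n) (Coef n (M + 2))).comp
        (ContinuousLinearMap.snd ℝ (Sp n) (Sp n × Coef n (M + 2))))) with hP
  have hPapp : ∀ q, P q = (0, 0, q.2.2) := fun q => rfl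
  set u : ℝ × St n (M + 2) → St n (M + 2) := fun p => P (v p) with hu
  have hus : ContDiff ℝ ∞ u := P.contDiff.comp hv
  have huc : HasCompactSupport u := hvc.comp_left (g := P) (map_zero P)
  obtain ⟨K', hK'⟩ := hus.lipschitzWith_of_hasCompactSupport huc (by simp)
  obtain ⟨L', hL'⟩ := huc.exists_bound_of_continuous hus.continuous
  have hv0 : a < b → ∀ t ∈ Icc a b, v (t, z) = 0 := by
    intro hlt t ht
    rw [(hloc t ⟨by linarith [ht.1], by linarith [ht.2]⟩ z (by simpa using hη)).1]
    exact field_eq_zero_of_flat hf (hflat hlt t ht)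
  obtain ⟨δ, hδ, hδ1, hstay⟩ := exists_stay_near hK hL hab hv0 hη
  -- The curve e will stay within ρ of z, so points within ρ of e are within 2 ρ of z: there v is
  -- `field f`, and curves of v through them remain near z.
  set ρ := min δ η / 2 with hρ
  have hρ0 : 0 < ρ := half_pos (lt_min hδ hη)
  have hρδ : 2 * ρ ≤ δ := by rw [hρ]; linarith [min_le_left δ η]
  have hρη : 2 * ρ ≤ η := by rw [hρ]; linarith [min_le_right δ η]
  obtain ⟨δ', hδ', hδ1', hstay'⟩ := exists_stay_near hK' hL' hab
    (fun hlt t ht => by simp only [hu]; rw [hv0 hlt t ht, map_zero]) hρ0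
  set ε := min δ' (min δ η) with hε
  have hε0 : 0 < ε := lt_min hδ' (lt_min hδ hη)
  have hεδ' : ε ≤ δ' := min_le_left _ _
  have hεδ : ε ≤ δ := (min_le_right _ _).trans (min_le_left _ _)
  have hεη : ε ≤ η := (min_le_right _ _).trans (min_le_right _ _)
  obtain ⟨s₀, t₀, hs₀, hst₀, ht₀, hpos, hneg⟩ := hsign ε hε0
  dsimp only at hpos hneg
  have hI : Icc (a - ε) (b + ε) ⊆ Ioo (a - 2) (b + 2) := fun t ht =>
    ⟨by linarith [ht.1], by linarith [ht.2]⟩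
  have hs₀I : s₀ ∈ Icc (a - ε) (b + ε) := ⟨hs₀.le, by linarith⟩
  have hsub : Icc s₀ t₀ ⊆ Icc (a - ε) (b + ε) := Icc_subset_Icc hs₀.le ht₀.le
  have hmem : ∀ d, ε ≤ d → ∀ t ∈ Icc (a - ε) (b + ε), t ∈ Icc (a - d) (b + d) :=
    fun d hd t ht => ⟨by linarith [ht.1], by linarith [ht.2]⟩
  obtain ⟨e, he0, he⟩ := exists_isTraj hK' hL' (hI hs₀I) z
  have hez : ∀ t ∈ Icc (a - ε) (b + ε), dist (e t) z < ρ := fun t ht =>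
    hstay' e he s₀ (hmem _ hεδ' _ hs₀I) (by rw [he0, dist_self]; exact hδ') t (hmem _ hεδ' _ ht)
  have hnear : ∀ t ∈ Icc s₀ t₀, ∀ z', dist z' (e t) < ρ → dist z' z < 2 * ρ := by
    intro t ht z' hz'
    have := dist_triangle z' (e t) z
    have := hez t (hsub ht)
    linarith
  have hloc' : ∀ t ∈ Icc s₀ t₀, ∀ z', dist z' (e t) < ρ → _ := fun t ht z' hz' =>
    hloc t (hmem _ hεη t (hsub ht)) z' ((hnear t ht z' hz').trans_le hρη)
  have hconst : ∀ t ∈ Icc s₀ t₀, ((e t).1, (e t).2.1) = (x, ξ) := by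
    have hd : ∀ t ∈ Icc s₀ t₀, HasDerivAt (fun t => ((e t).1, (e t).2.1)) 0 t := by
      intro t ht
      have := he t (hI (hsub ht))
      exact this.fst.prodMk this.snd.fst
    intro t ht
    rw [constant_of_has_deriv_right_zero
      (fun t ht => (hd t ht).continuousAt.continuousWithinAt)
      (fun t ht => (hd t ⟨ht.1, ht.2.le⟩).hasDerivWithinAt) t ht, he0]
  have hsymb : ∀ t ∈ Icc s₀ t₀, symbSt f (t, e t) = f (t, x, ξ) := by
    intro t ht
    have h1 := hconst t ht
    simp only [Prod.mk.injEq] at h1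
    simp only [symbSt, h1.1, h1.2]
  obtain ⟨γ, hγ, s, hs, t, ht, hst, hds, hfs, hft⟩ := exists_isTraj_sign_change
    (ψ := symbSt f) hK' hK hL
    ((contDiff_symbSt hf).of_le (mod_cast le_top)) he (hI hs₀I).1 hst₀.le
    (hI (hsub ⟨hst₀.le, le_rfl⟩)).2 hρ0
    (by
      intro t ht z' hz' h0
      rw [fderiv_symbSt hf]
      -- As u has no component in (y, η), the derivative along (1, u) is just ∂_t f.
      exact hmono _ (hloc' t ht z' hz').2.1 h0)
    (by
      intro t ht z' hz' h0 hq
      simp only [hu, hPapp, (hloc' t ht z' hz').1]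
      refine field_eq_of_fderiv_eq_zero fun y y' => ?_
      have := hq (y, y', 0)
      rwa [fderiv_symbSt hf] at this)
    (by rw [hsymb _ ⟨le_rfl, hst₀.le⟩]; exact hpos)
    (by rw [hsymb _ ⟨hst₀.le, le_rfl⟩]; exact hneg)
  -- Closeness of γ to z at the single time s propagates to a neighborhood of [a, b], where γ is
  -- therefore a curve of `field f` itself.
  have hall : ∀ t ∈ Icc (a - ε) (b + ε), _ := fun t ht =>
    hloc t (hmem _ hεη t ht) (γ t) (hstay γ hγ s (hmem _ hεδ _ (hsub hs))
      ((hnear s hs _ hds).trans_le hρδ) t (hmem _ hεδ _ ht))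
  refine ⟨a - ε, b + ε, γ, 1 / 2, s, t, by norm_num,
    (hγ.contDiffOn hv).mono (Ioo_subset_Icc_self.trans hI),
    fun t ht => (hall t ht).1 ▸ hγ t (hI ht), fun t ht => (hall t ht).2.1,
    fun t ht => (hall t ht).2.2, by linarith [hs.1], hst, by linarith [ht.2], hfs, hft,
    fun t ht => ⟨by linarith [ht.1], by linarith [ht.2]⟩⟩

end Eikonal

/-! ### The main theorem -/

theorem proposition5p2 (n : ℕ) (a b : ℝ) (hab : a ≤ b)
    (x ξ : EuclideanSpace ℝ (Fin n))
    (V : Set (ℝ × EuclideanSpace ℝ (Fin n) × EuclideanSpace ℝ (Fin n)))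
    (hV : IsOpen V) (hΓV : Eikonal.gam a b x ξ ⊆ V)
    (f : ℝ × EuclideanSpace ℝ (Fin n) × EuclideanSpace ℝ (Fin n) → ℝ)
    (hf : ContDiffOn ℝ ∞ f V)
    (hsign : Eikonal.ChangesSignNear (fun t => f (t, x, ξ)) a b)
    (hflat : a < b → ∀ p ∈ Eikonal.gam a b x ξ, ∀ m : ℕ, iteratedFDeriv ℝ m f p = 0)
    (Ω : Set (ℝ × EuclideanSpace ℝ (Fin n) × EuclideanSpace ℝ (Fin n)))
    (hΩ : IsOpen Ω) (hΓΩ : Eikonal.gam a b x ξ ⊆ Ω) (M : ℕ) :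
    ∃ (K : ℕ) (s₁ t₁ t₂ s₂ r c : ℝ) (w₀ : ℝ → ℂ) (x₀ ξ₀ : ℝ → EuclideanSpace ℝ (Fin n))
      (w : (Fin n → ℕ) → ℝ → ℂ),
      2 ≤ K ∧ s₁ < t₁ ∧ t₁ < t₂ ∧ t₂ < s₂ ∧ 0 < r ∧ 0 < c ∧
      -- smoothness of all the coefficients of the phase
      ContDiffOn ℝ ∞ w₀ (Set.Ioo s₁ s₂) ∧ ContDiffOn ℝ ∞ x₀ (Set.Ioo s₁ s₂) ∧
      ContDiffOn ℝ ∞ ξ₀ (Set.Ioo s₁ s₂) ∧ (∀ α, ContDiffOn ℝ ∞ (w α) (Set.Ioo s₁ s₂)) ∧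
      -- the curve, with a tube around it, lies in the prescribed neighborhood of `Γ`
      (∀ t ∈ Set.Ioo s₁ s₂, ∀ y, ‖y - x₀ t‖ < r → (t, y, ξ₀ t) ∈ V ∩ Ω) ∧
      -- the eikonal equation holds in the tube modulo `O(|y - x₀(t)|^M)`
      (∀ N, M ≤ N → ∃ C : ℝ, ∀ t ∈ Set.Ioo s₁ s₂, ∀ y, ‖y - x₀ t‖ < r →
        ‖Eikonal.eikonalLHS N f ξ₀ (Eikonal.phase K w₀ x₀ ξ₀ w) t y‖ ≤ C * ‖y - x₀ t‖ ^ M) ∧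
      -- `Im w₂ ≥ c`
      (∀ t ∈ Set.Icc t₁ t₂, ∀ v, c * ‖v‖ ^ 2 ≤ Eikonal.imW2 w t v) ∧
      -- `min Im w₀ = 0` over `(t₁, t₂)` and `Im w₀ = c` at the endpoints
      IsLeast ((fun t => (w₀ t).im) '' Set.Ioo t₁ t₂) 0 ∧
      (w₀ t₁).im = c ∧ (w₀ t₂).im = c ∧
      -- if `∂_t f ≥ 0` on the zeros of `f`, then the time interval contains all of `[a, b]`
      ((∀ p ∈ V, f p = 0 → 0 ≤ fderiv ℝ f p (1, 0, 0)) → Set.Icc a b ⊆ Set.Ioo s₁ s₂) := by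
  have hΓ : IsCompact (Eikonal.gam a b x ξ) := isCompact_Icc.image (by fun_prop)
  obtain ⟨g, hg, -, U, hU, hΓU, hUVΩ, hgf⟩ :=
    Eikonal.exists_contDiff_hasCompactSupport_eqOn (hV.inter hΩ) hΓ (Set.subset_inter hΓV hΓΩ)
      (hf.mono Set.inter_subset_left)
  have hev : ∀ p ∈ U, g =ᶠ[nhds p] f := fun p hp => by
    filter_upwards [hU.mem_nhds hp] with q hq using hgf hq
  -- In the first case p violates the monotonicity hypothesis, so the last clause is vacuous. In the
  -- second case monotonicity holds on U, and the curve obtained is defined around all of [a, b].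
  by_cases hneg : ∃ p ∈ U, g p = 0 ∧ fderiv ℝ g p (1, 0, 0) < 0
  · obtain ⟨p, hp, hp0, hplt⟩ := hneg
    obtain ⟨s₁, s₂, e, c₀, s, t, hc₀, hes, he, heU, hc, hs, hst, ht, hpos, hlt⟩ :=
      Eikonal.exists_curve_of_fderiv_neg (M := M) hg hU hp hp0 hplt
    obtain ⟨K, t₁, t₂, r, c, w₀, x₀, ξ₀, w, h1, h2, h3, h4, h5, h6, h7, h8, h9, h10, h11, h12,
      h13, h14, h15, h16⟩ := Eikonal.exists_phase_of_curve hU hUVΩ hg hgf.symm hes he heU hc₀ hc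
        hs hst ht hpos hlt
    refine ⟨K, s₁, t₁, t₂, s₂, r, c, w₀, x₀, ξ₀, w, h1, h2, h3, h4, h5, h6, h7, h8, h9, h10, h11,
      h12, h13, h14, h15, h16, fun hmono => ?_⟩
    have := hmono p (hUVΩ hp).1 (by rw [← hgf hp]; exact hp0)
    rw [← (hev p hp).fderiv_eq] at this
    exact absurd hplt (not_lt.mpr this)
  · push Not at hneg
    -- The two points of the sign change are taken so close to [a, b] that they lie over U, where g
    -- = f.
    have hsign' : Eikonal.ChangesSignNear (fun t => g (t, x, ξ)) a b := by
      intro ε hε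
      obtain ⟨η, hη, htube⟩ := Eikonal.exists_tube (z := (x, ξ)) hU
        (fun t ht => hΓU ⟨t, ht, rfl⟩) hab
      obtain ⟨s, t, hs, hst, ht, hpos, hlt⟩ := hsign (min ε η) (lt_min hε hη)
      have h1 := min_le_left ε η
      have h2 := min_le_right ε η
      have hmem : ∀ τ, a - min ε η < τ → τ < b + min ε η → (τ, x, ξ) ∈ U := fun τ h3 h4 =>
        htube τ ⟨by linarith, by linarith⟩ (x, ξ) (by simpa using hη)
      refine ⟨s, t, by linarith, hst, by linarith, ?_, ?_⟩
      · change 0 < g (s, x, ξ)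
        rw [hgf (hmem s hs (by linarith))]; exact hpos
      · change g (t, x, ξ) < 0
        rw [hgf (hmem t (by linarith) ht)]; exact hlt
    obtain ⟨s₁, s₂, e, c₀, s, t, hc₀, hes, he, heU, hc, hs, hst, ht, hpos, hlt, hJ⟩ :=
      Eikonal.exists_curve_of_fderiv_nonneg (M := M) hg hU hab (x := x) (ξ := ξ)
        (fun t ht => hΓU ⟨t, ht, rfl⟩) (fun hlt t ht m => by
          rw [((hev _ (hΓU ⟨t, ht, rfl⟩)).iteratedFDeriv ℝ m).eq_of_nhds]
          exact hflat hlt _ ⟨t, ht, rfl⟩ m) hneg hsign'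
    obtain ⟨K, t₁, t₂, r, c, w₀, x₀, ξ₀, w, h1, h2, h3, h4, h5, h6, h7, h8, h9, h10, h11, h12,
      h13, h14, h15, h16⟩ := Eikonal.exists_phase_of_curve hU hUVΩ hg hgf.symm hes he heU hc₀ hc
        hs hst ht hpos hlt
    exact ⟨K, s₁, t₁, t₂, s₂, r, c, w₀, x₀, ξ₀, w, h1, h2, h3, h4, h5, h6, h7, h8, h9, h10, h11,
      h12, h13, h14, h15, h16, fun _ => hJ⟩
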